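/- Let $g \ge 3$ be an integer. For a complex number $c \in \mathbb{C} \setminus \{-2g, 0, 1, \dots, 2g-1\}$ let $C_c$ denote the hyperelliptic curve of genus $g$ given by the equation $$ w^2 = (z-c)(z+2g)\prod_{i=0}^{2g-1}(z-i), $$ that is, the smooth projective complex curve which is the closed subscheme of the weighted projective plane $\mathbb{P}(1,1,g+1)$ over $\mathbb{C}$, with coordinates $z, t, w$, defined by $w^2 = (z-ct)(z+2gt)\prod_{i=0}^{2g-1}(z-it)$. Let $a \in \mathbb{C} \setminus \mathbb{Q}$ and let $b \in \mathbb{C} \setminus \{-2g, 0, 1, \dots, 2g-1\}$. Then $C_a \cong C_b$ (as algebraic curves over $\mathbb{C}$) if and only if $a = b$. -/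

import Mathlib

open CategoryTheory AlgebraicGeometry

namespace HyperellipticFamily

noncomputable section

/-! ### The grading on the quotient of a graded algebra by a homogeneous ideal -/

section QuotientGrading

/-- The degree `n` part of `A ⧸ I`: the image of the degree `n` part of `A`. -/
def quotientGrading {R A : Type*} [CommRing R] [CommRing A] [Algebra R A]
    (𝒜 : ℕ → Submodule R A) (I : Ideal A) (n : ℕ) : Submodule R (A ⧸ I) :=
  (𝒜 n).map (Ideal.Quotient.mkₐ R I).toLinearMap

theorem mk_mem_quotientGrading {R A : Type*} [CommRing R] [CommRing A] [Algebra R A]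
    (𝒜 : ℕ → Submodule R A) (I : Ideal A) {n : ℕ} {x : A} (hx : x ∈ 𝒜 n) :
    Ideal.Quotient.mk I x ∈ quotientGrading 𝒜 I n :=
  ⟨x, hx, rfl⟩

/-- The projection `𝒜 n → (A ⧸ I)_n`. -/
def quotientGradingProj {R A : Type*} [CommRing R] [CommRing A] [Algebra R A]
    (𝒜 : ℕ → Submodule R A) (I : Ideal A) (n : ℕ) : 𝒜 n →+ quotientGrading 𝒜 I n where
  toFun x := ⟨Ideal.Quotient.mk I x, mk_mem_quotientGrading 𝒜 I x.2⟩
  map_zero' := by ext; simp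
  map_add' x y := by ext; simp

/-- The decomposition of an element of `A`, followed by projection to `A ⧸ I` in each degree. -/
def quotientDecomposeAux {R A : Type*} [CommRing R] [CommRing A] [Algebra R A]
    (𝒜 : ℕ → Submodule R A) [GradedAlgebra 𝒜] (I : Ideal A) :
    A →+ DirectSum ℕ (fun n => quotientGrading 𝒜 I n) :=
  (DirectSum.map (quotientGradingProj 𝒜 I)).comp
    (DirectSum.decomposeAddEquiv 𝒜).toAddMonoidHom

theorem quotientDecomposeAux_of_mem {R A : Type*} [CommRing R] [CommRing A] [Algebra R A]
    (𝒜 : ℕ → Submodule R A) [GradedAlgebra 𝒜] (I : Ideal A) {n : ℕ} {x : A} (hx : x ∈ 𝒜 n) :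
    quotientDecomposeAux 𝒜 I x =
      DirectSum.of (fun n => quotientGrading 𝒜 I n) n
        ⟨Ideal.Quotient.mk I x, mk_mem_quotientGrading 𝒜 I hx⟩ := by
  simp only [quotientDecomposeAux, AddMonoidHom.comp_apply]
  change DirectSum.map (quotientGradingProj 𝒜 I) (DirectSum.decompose 𝒜 x) = _
  rw [DirectSum.decompose_of_mem 𝒜 hx, DirectSum.map_of]
  rfl

theorem quotientDecomposeAux_eq_zero {R A : Type*} [CommRing R] [CommRing A] [Algebra R A]
    (𝒜 : ℕ → Submodule R A) [GradedAlgebra 𝒜] (I : Ideal A) (hI : I.IsHomogeneous 𝒜)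
    {x : A} (hx : x ∈ I) : quotientDecomposeAux 𝒜 I x = 0 := by
  ext n
  change Ideal.Quotient.mk I (DirectSum.decompose 𝒜 x n : A) = 0
  exact Ideal.Quotient.eq_zero_iff_mem.mpr (hI n hx)

/-- The decomposition of an element of `A ⧸ I` into its homogeneous components. -/
def quotientDecompose {R A : Type*} [CommRing R] [CommRing A] [Algebra R A]
    (𝒜 : ℕ → Submodule R A) [GradedAlgebra 𝒜] (I : Ideal A) (hI : I.IsHomogeneous 𝒜) :
    A ⧸ I →+ DirectSum ℕ (fun n => quotientGrading 𝒜 I n) :=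
  QuotientAddGroup.lift I.toAddSubgroup (quotientDecomposeAux 𝒜 I)
    (fun _ hx => quotientDecomposeAux_eq_zero 𝒜 I hI hx)

theorem quotientDecompose_mk {R A : Type*} [CommRing R] [CommRing A] [Algebra R A]
    (𝒜 : ℕ → Submodule R A) [GradedAlgebra 𝒜] (I : Ideal A) (hI : I.IsHomogeneous 𝒜) (x : A) :
    quotientDecompose 𝒜 I hI (Ideal.Quotient.mk I x) = quotientDecomposeAux 𝒜 I x :=
  rfl

/-- The quotient of a graded algebra by a homogeneous ideal is a graded algebra. -/
@[reducible]
def quotientGradedAlgebra {R A : Type*} [CommRing R] [CommRing A] [Algebra R A]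
    (𝒜 : ℕ → Submodule R A) [GradedAlgebra 𝒜] (I : Ideal A) (hI : I.IsHomogeneous 𝒜) :
    GradedAlgebra (quotientGrading 𝒜 I) where
  one_mem := mk_mem_quotientGrading 𝒜 I SetLike.GradedOne.one_mem
  mul_mem := by
    rintro i j _ _ ⟨x, hx, rfl⟩ ⟨y, hy, rfl⟩
    exact ⟨x * y, SetLike.GradedMul.mul_mem hx hy, map_mul (Ideal.Quotient.mk I) x y⟩
  toDecomposition := DirectSum.Decomposition.ofAddHom (quotientGrading 𝒜 I)
    (quotientDecompose 𝒜 I hI)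
    (by
      refine AddMonoidHom.ext fun x => ?_
      obtain ⟨x, rfl⟩ := Ideal.Quotient.mk_surjective x
      rw [AddMonoidHom.comp_apply, quotientDecompose_mk, AddMonoidHom.id_apply]
      induction x using DirectSum.Decomposition.inductionOn 𝒜 with
      | zero => simp
      | homogeneous m =>
        rw [quotientDecomposeAux_of_mem 𝒜 I m.2, DirectSum.coeAddMonoidHom_of]
      | add m m' h h' => rw [map_add, map_add, h, h', map_add])
    (by
      refine DirectSum.addHom_ext fun n y => ?_
      obtain ⟨_, x, hx, rfl⟩ := y
      rw [AddMonoidHom.comp_apply, DirectSum.coeAddMonoidHom_of, AddMonoidHom.id_apply]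
      exact quotientDecomposeAux_of_mem 𝒜 I hx)

end QuotientGrading

/-! ### The curves -/

open MvPolynomial

/-- The weights of the variables `X 0 = z`, `X 1 = t`, `X 2 = w` of the weighted projective
plane `ℙ(1, 1, g + 1)`; here `z` and `t` are homogeneous coordinates on `ℙ¹`. -/
def weights (g : ℕ) : Fin 3 → ℕ := ![1, 1, g + 1]

/-- The polynomial `w² - (z - a t) (z + 2g t) ∏_{i=0}^{2g-1} (z - i t)`. Setting `t = 1` gives the
affine equation `w² = (z - a) (z + 2g) ∏_{i=0}^{2g-1} (z - i)`; setting `z = 1` gives the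
affine equation of the curve over a neighbourhood of `z = ∞`. -/
def equation (g : ℕ) (a : ℂ) : MvPolynomial (Fin 3) ℂ :=
  X 2 ^ 2 - (X 0 - C a * X 1) * (X 0 + C (2 * (g : ℂ)) * X 1) *
    ∏ i ∈ Finset.range (2 * g), (X 0 - C (i : ℂ) * X 1)

theorem equation_isWeightedHomogeneous (g : ℕ) (a : ℂ) :
    (equation g a).IsWeightedHomogeneous (weights g) (2 * (g + 1)) := by
  have h0 : (X 0 : MvPolynomial (Fin 3) ℂ).IsWeightedHomogeneous (weights g) 1 :=
    isWeightedHomogeneous_X ℂ (weights g) 0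
  have h1 (c : ℂ) : (C c * X 1 : MvPolynomial (Fin 3) ℂ).IsWeightedHomogeneous (weights g) 1 := by
    simpa [weights] using
      (isWeightedHomogeneous_C (weights g) c).mul (isWeightedHomogeneous_X ℂ (weights g) 1)
  have h2 : (X 2 : MvPolynomial (Fin 3) ℂ).IsWeightedHomogeneous (weights g) (g + 1) :=
    isWeightedHomogeneous_X ℂ (weights g) 2
  have hs (c : ℂ) : (X 0 - C c * X 1 : MvPolynomial (Fin 3) ℂ).IsWeightedHomogeneous
      (weights g) 1 := (weightedHomogeneousSubmodule ℂ (weights g) 1).sub_mem h0 (h1 c)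
  have hp : (∏ i ∈ Finset.range (2 * g), (X 0 - C (i : ℂ) * X 1) :
      MvPolynomial (Fin 3) ℂ).IsWeightedHomogeneous (weights g) (2 * g) := by
    simpa using IsWeightedHomogeneous.prod (Finset.range (2 * g)) _ (fun _ => 1)
      (fun i _ => hs (i : ℂ))
  refine (weightedHomogeneousSubmodule ℂ (weights g) (2 * (g + 1))).sub_mem ?_ ?_
  · simpa using h2.pow 2
  · have h := ((hs a).mul (h0.add (h1 (2 * (g : ℂ))))).mul hp
    rwa [show 1 + 1 + 2 * g = 2 * (g + 1) by ring] at h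

/-- The homogeneous coordinate ring `ℂ[z, t, w] / (equation)` of the curve. -/
abbrev CoordRing (g : ℕ) (a : ℂ) : Type :=
  MvPolynomial (Fin 3) ℂ ⧸ Ideal.span {equation g a}

/-- The grading of the homogeneous coordinate ring with `z`, `t` in degree `1` and `w` in
degree `g + 1`. -/
def coordGrading (g : ℕ) (a : ℂ) : ℕ → Submodule ℂ (CoordRing g a) :=
  quotientGrading (weightedHomogeneousSubmodule ℂ (weights g)) (Ideal.span {equation g a})

instance coordGradedAlgebra (g : ℕ) (a : ℂ) : GradedAlgebra (coordGrading g a) :=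
  letI := weightedGradedAlgebra ℂ (weights g)
  quotientGradedAlgebra (weightedHomogeneousSubmodule ℂ (weights g)) (Ideal.span {equation g a})
    (Ideal.homogeneous_span _ _ (by
      rintro _ rfl
      exact ⟨2 * (g + 1), equation_isWeightedHomogeneous g a⟩))

/-- The projective curve `C_a` with equation `w² = (z - a) (z + 2g) ∏_{i=0}^{2g-1} (z - i)`, as a
scheme over `Spec ℂ`: the closed subscheme `Proj` of the weighted projective plane
`ℙ(1, 1, g + 1)`. It is covered by the affine curves `t ≠ 0` and `z ≠ 0`, which are the two standard
charts of the smooth projective model of a hyperelliptic curve with equation of even degree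
`2g + 2`; if `a` is none of `-2g, 0, …, 2g - 1`, it is smooth of genus `g`. -/
def curve (g : ℕ) (a : ℂ) : Over (Spec (CommRingCat.of ℂ)) :=
  Over.mk (Proj.toSpecZero (coordGrading g a) ≫
    Spec.map (CommRingCat.ofHom (algebraMap ℂ (coordGrading g a 0))))

/-- The values excluded for the parameter `a`: the numbers `-2g, 0, 1, …, 2g - 1`. -/
def excluded (g : ℕ) : Set ℂ :=
  {c | c = -(2 * (g : ℂ)) ∨ ∃ i : ℕ, i < 2 * g ∧ c = (i : ℂ)}

end

end HyperellipticFamily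

namespace HyperellipticFamily

/-! ### Cross ratios and the set `{-2g, 0, …, 2g - 1}` -/

/-! An isomorphism of curves gives a `ℂ`-isomorphism of function fields, so a single field `L`
carries two hyperelliptic pairs: `(x, y)` with `y² = f(x)` from `C_a` and `(x', y')` with `y'² =
f'(x')` from `C_b`. The proof first shows that the degree 2 map to the line is unique up to a Möbius
transformation, and then that only `a = b` is compatible with the branch points.

Uniqueness is elementary (`IsHyperellipticPair.mem_adjoin`). If `x'` were not in `k(x)`, then `x`
and `x'` would satisfy an irreducible relation of degree 2 in `x'` and at most 2 in `x`. Its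
discriminant has degree at most 4 in `x`, yet it is `f` up to squares of rational functions, and `f`
is squarefree of degree at least 5. Hence `x' ∈ k(x)`. The relation then has degree at most 1 in
each variable, so `x'` is a Möbius function of `x`, and comparing `y²` with `y'²` shows that roots
of `f` go to roots of `f'` (`IsHyperellipticPair.exists_mobius`).

The rest is arithmetic of cross ratios (`eq_of_mobius`). A cross ratio of three integers and the
irrational `a` cannot equal a cross ratio of four integers, so `a` goes to `b` and the integral
branch points are permuted. A real Möbius map preserves the cyclic order, so this permutation is a
symmetry of the cycle `-2g, 0, 1, …, 2g - 1`. Cross ratios of nearby points exclude every symmetry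
that moves `-2g`, `0` or `2g - 1` (`fixes_of_crossRatio`). With three fixed points the
transformation is the identity, so `a = b`. -/

theorem mobius_denom_ne_zero {K : Type*} [Field K] {α β γ δ r s : K}
    (hD : α * δ - β * γ ≠ 0) (h : α * r + β = s * (γ * r + δ)) : γ * r + δ ≠ 0 := by
  intro h0
  rw [h0, mul_zero] at h
  apply hD
  by_cases hγ : γ = 0
  · subst hγ
    have : δ = 0 := by simpa using h0
    simp [this]
  · have : γ * (α * δ - β * γ) = 0 := by linear_combination γ * α * h0 - γ * γ * h
    exact (mul_eq_zero.mp this).resolve_left hγ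

theorem mobius_sub {K : Type*} [Field K] {α β γ δ r s r' s' : K}
    (h : α * r + β = s * (γ * r + δ)) (h' : α * r' + β = s' * (γ * r' + δ)) :
    (s - s') * ((γ * r + δ) * (γ * r' + δ)) = (α * δ - β * γ) * (r - r') := by
  linear_combination (-(γ * r' + δ)) * h + (γ * r + δ) * h'

theorem mobius_injective {K : Type*} [Field K] {α β γ δ r r' s : K}
    (hD : α * δ - β * γ ≠ 0) (h : α * r + β = s * (γ * r + δ))
    (h' : α * r' + β = s * (γ * r' + δ)) : r = r' := by
  have := mobius_sub h h'
  rw [sub_self, zero_mul] at this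
  exact sub_eq_zero.mp ((mul_eq_zero.mp this.symm).resolve_left hD)

/-- A Möbius transformation preserves cross ratios. -/
theorem mobius_crossRatio {K : Type*} [Field K] {α β γ δ r₁ r₂ r₃ r₄ s₁ s₂ s₃ s₄ : K}
    (hD : α * δ - β * γ ≠ 0) (h₁ : α * r₁ + β = s₁ * (γ * r₁ + δ))
    (h₂ : α * r₂ + β = s₂ * (γ * r₂ + δ)) (h₃ : α * r₃ + β = s₃ * (γ * r₃ + δ))
    (h₄ : α * r₄ + β = s₄ * (γ * r₄ + δ)) :
    (r₁ - r₂) * (r₃ - r₄) * ((s₁ - s₃) * (s₂ - s₄)) =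
      (r₁ - r₃) * (r₂ - r₄) * ((s₁ - s₂) * (s₃ - s₄)) := by
  have n₁ := mobius_denom_ne_zero hD h₁
  have n₂ := mobius_denom_ne_zero hD h₂
  have n₃ := mobius_denom_ne_zero hD h₃
  have n₄ := mobius_denom_ne_zero hD h₄
  have e₁₃ := mobius_sub h₁ h₃
  have e₂₄ := mobius_sub h₂ h₄
  have e₁₂ := mobius_sub h₁ h₂
  have e₃₄ := mobius_sub h₃ h₄
  generalize γ * r₁ + δ = l₁ at *
  generalize γ * r₂ + δ = l₂ at *
  generalize γ * r₃ + δ = l₃ at *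
  generalize γ * r₄ + δ = l₄ at *
  generalize α * δ - β * γ = D at *
  have hl : l₁ * l₂ * (l₃ * l₄) ≠ 0 := mul_ne_zero (mul_ne_zero n₁ n₂) (mul_ne_zero n₃ n₄)
  refine mul_right_cancel₀ hl ?_
  calc _ = (r₁ - r₂) * (r₃ - r₄) * (((s₁ - s₃) * (l₁ * l₃)) * ((s₂ - s₄) * (l₂ * l₄))) := by ring
    _ = (r₁ - r₃) * (r₂ - r₄) * (((s₁ - s₂) * (l₁ * l₂)) * ((s₃ - s₄) * (l₃ * l₄))) := by
        rw [e₁₃, e₂₄, e₁₂, e₃₄]; ring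
    _ = _ := by ring

/-! ### The integral branch points and their cyclic order. -/

/-- The integers `-2g, 0, 1, …, 2g - 1`. -/
noncomputable def branchInts (g : ℕ) : Finset ℤ := insert (-(2 * (g : ℤ))) (Finset.Ico 0 (2 * (g : ℤ)))

theorem mem_branchInts {g : ℕ} {n : ℤ} :
    n ∈ branchInts g ↔ n = -(2 * (g : ℤ)) ∨ (0 ≤ n ∧ n < 2 * (g : ℤ)) := by
  simp [branchInts]

theorem mem_excluded_iff {g : ℕ} {c : ℂ} : c ∈ excluded g ↔ ∃ n ∈ branchInts g, c = (n : ℂ) := by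
  constructor
  · rintro (h | ⟨i, hi, h⟩)
    · exact ⟨-(2 * (g : ℤ)), mem_branchInts.2 (Or.inl rfl), by rw [h]; push_cast; ring⟩
    · exact ⟨i, mem_branchInts.2 (Or.inr ⟨by omega, by omega⟩), by rw [h]; simp⟩
  · rintro ⟨n, hn, rfl⟩
    rcases mem_branchInts.1 hn with h | ⟨h, h'⟩
    · left; rw [h]; push_cast; ring
    · right
      refine ⟨n.toNat, by omega, ?_⟩
      exact_mod_cast congrArg (Int.cast : ℤ → ℂ) (Int.toNat_of_nonneg h).symm

/-- Adjacency in the cyclic order induced from the real projective line. -/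
def CyclicAdj (S : Finset ℤ) (u v : ℤ) : Prop :=
  u ∈ S ∧ v ∈ S ∧ u ≠ v ∧
    -- The sign of `(u - w) * (v - w)` tells whether `w` lies between `u` and `v`. So the other
    -- points are all between them or all outside, and neither arc is preferred.
    ∀ w ∈ S, ∀ z ∈ S, w ≠ u → w ≠ v → z ≠ u → z ≠ v → 0 < (u - w) * (v - w) * ((u - z) * (v - z))

theorem CyclicAdj.symm {S : Finset ℤ} {u v : ℤ} (h : CyclicAdj S u v) : CyclicAdj S v u :=
  ⟨h.2.1, h.1, h.2.2.1.symm, fun w hw z hz h1 h2 h3 h4 => by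
    have := h.2.2.2 w hw z hz h2 h1 h4 h3
    linarith [mul_comm (u - w) (v - w), mul_comm (u - z) (v - z),
      show (v - w) * (u - w) * ((v - z) * (u - z)) = (u - w) * (v - w) * ((u - z) * (v - z)) by
        ring]⟩

theorem cyclicAdj_succ {g : ℕ} {u : ℤ} (h0 : 0 ≤ u) (h1 : u + 1 < 2 * (g : ℤ)) :
    CyclicAdj (branchInts g) u (u + 1) := by
  refine ⟨mem_branchInts.2 (by omega), mem_branchInts.2 (by omega), by omega, ?_⟩
  have key : ∀ w, w ≠ u → w ≠ u + 1 → 0 < (u - w) * (u + 1 - w) := by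
    intro w hw hw'
    rcases lt_or_gt_of_ne hw with h | h
    · exact mul_pos (by omega) (by omega)
    · exact mul_pos_of_neg_of_neg (by omega) (by omega)
  exact fun w _ z _ h2 h3 h4 h5 => mul_pos (key w h2 h3) (key z h4 h5)

theorem cyclicAdj_neg_zero {g : ℕ} (hg : 3 ≤ g) :
    CyclicAdj (branchInts g) (-(2 * (g : ℤ))) 0 := by
  refine ⟨mem_branchInts.2 (by omega), mem_branchInts.2 (by omega), by omega, ?_⟩
  have key : ∀ w ∈ branchInts g, w ≠ -(2 * (g : ℤ)) → w ≠ 0 →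
      0 < (-(2 * (g : ℤ)) - w) * (0 - w) := by
    intro w hw hw' hw''
    rw [mem_branchInts] at hw
    exact mul_pos_of_neg_of_neg (by omega) (by omega)
  exact fun w hw z hz h2 h3 h4 h5 => mul_pos (key w hw h2 h3) (key z hz h4 h5)

/-- These two are neighbours through `∞`: all other points lie between them, so both factors in the
condition are negative. -/
theorem cyclicAdj_neg_last {g : ℕ} (hg : 3 ≤ g) :
    CyclicAdj (branchInts g) (-(2 * (g : ℤ))) (2 * (g : ℤ) - 1) := by
  refine ⟨mem_branchInts.2 (by omega), mem_branchInts.2 (by omega), by omega, ?_⟩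
  have key : ∀ w ∈ branchInts g, w ≠ -(2 * (g : ℤ)) → w ≠ 2 * (g : ℤ) - 1 →
      (-(2 * (g : ℤ)) - w) * (2 * (g : ℤ) - 1 - w) < 0 := by
    intro w hw hw' hw''
    rw [mem_branchInts] at hw
    exact mul_neg_of_neg_of_pos (by omega) (by omega)
  exact fun w hw z hz h2 h3 h4 h5 => mul_pos_of_neg_of_neg (key w hw h2 h3) (key z hz h4 h5)

/-- For any other pair `u < v` there is a point strictly between (`0` or `u + 1`) and one outside
(`2g - 1` or `-2g`). -/
theorem CyclicAdj.cases_of_lt {g : ℕ} (hg : 3 ≤ g) {u v : ℤ} (h : CyclicAdj (branchInts g) u v)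
    (huv : u < v) :
    (0 ≤ u ∧ v = u + 1) ∨ (u = -(2 * (g : ℤ)) ∧ (v = 0 ∨ v = 2 * (g : ℤ) - 1)) := by
  obtain ⟨hu, hv, -, h⟩ := h
  by_contra hcon
  have key : ∀ w ∈ branchInts g, ∀ z ∈ branchInts g, u < w → w < v → z ≠ u → z ≠ v →
      0 < (u - z) * (v - z) → False := by
    intro w hw z hz h1 h2 h3 h4 h5
    have h6 := h w hw z hz (by omega) (by omega) h3 h4
    have h7 : (u - w) * (v - w) < 0 := mul_neg_of_neg_of_pos (by omega) (by omega)
    exact absurd h6 (mul_neg_of_neg_of_pos h7 h5).not_gt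
  rw [mem_branchInts] at hu hv
  rcases hu with hu | hu
  · exact key 0 (mem_branchInts.2 (by omega)) (2 * g - 1) (mem_branchInts.2 (by omega))
      (by omega) (by omega) (by omega) (by omega)
      (mul_pos_of_neg_of_neg (by omega) (by omega))
  · exact key (u + 1) (mem_branchInts.2 (by omega)) (-(2 * g)) (mem_branchInts.2 (by omega))
      (by omega) (by omega) (by omega) (by omega) (mul_pos (by omega) (by omega))

theorem CyclicAdj.cases {g : ℕ} (hg : 3 ≤ g) {u v : ℤ} (h : CyclicAdj (branchInts g) u v) :
    (0 ≤ u ∧ v = u + 1) ∨ (0 ≤ v ∧ u = v + 1) ∨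
      (u = -(2 * (g : ℤ)) ∧ (v = 0 ∨ v = 2 * (g : ℤ) - 1)) ∨
      (v = -(2 * (g : ℤ)) ∧ (u = 0 ∨ u = 2 * (g : ℤ) - 1)) := by
  rcases lt_or_gt_of_ne h.2.2.1 with h' | h'
  · have := h.cases_of_lt hg h'
    tauto
  · have := h.symm.cases_of_lt hg h'
    tauto

/-- By the equality of cross ratios, the product of the adjacency expression for `u, v, w, z` and
that for their images is a nonzero square, so the two have the same sign. Finiteness of `S` makes
`m` surjective, so every test point is an image. -/
theorem CyclicAdj.map {S : Finset ℤ} {m : ℤ → ℤ} (hm : ∀ n ∈ S, m n ∈ S)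
    (hinj : Set.InjOn m S)
    (hcr : ∀ r₁ ∈ S, ∀ r₂ ∈ S, ∀ r₃ ∈ S, ∀ r₄ ∈ S,
      (r₁ - r₂) * (r₃ - r₄) * ((m r₁ - m r₃) * (m r₂ - m r₄)) =
        (r₁ - r₃) * (r₂ - r₄) * ((m r₁ - m r₂) * (m r₃ - m r₄)))
    {u v : ℤ} (h : CyclicAdj S u v) : CyclicAdj S (m u) (m v) := by
  obtain ⟨hu, hv, huv, h⟩ := h
  have hsurj : ∀ w ∈ S, ∃ w' ∈ S, m w' = w := by
    intro w hw
    have : S.image m = S := Finset.eq_of_subset_of_card_le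
      (Finset.image_subset_iff.2 hm) (Finset.card_image_of_injOn hinj).ge
    rw [← this] at hw
    simpa using hw
  refine ⟨hm u hu, hm v hv, fun e => huv (hinj hu hv e), ?_⟩
  intro w' hw' z' hz' h1 h2 h3 h4
  obtain ⟨w, hw, rfl⟩ := hsurj w' hw'
  obtain ⟨z, hz, rfl⟩ := hsurj z' hz'
  have h1' : w ≠ u := fun e => h1 (by rw [e])
  have h2' : w ≠ v := fun e => h2 (by rw [e])
  have h3' : z ≠ u := fun e => h3 (by rw [e])
  have h4' : z ≠ v := fun e => h4 (by rw [e])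
  have key := h w hw z hz h1' h2' h3' h4'
  have c := hcr u hu w hw z hz v hv
  have n1 := sub_ne_zero.2 h1.symm
  have n2 := sub_ne_zero.2 h2.symm
  have n3 := sub_ne_zero.2 h3.symm
  have n4 := sub_ne_zero.2 h4.symm
  have hne : (u - z) * (w - v) * ((m u - m w) * (m z - m v)) ≠ 0 := by
    have a1 := sub_ne_zero.2 h3'.symm
    have a2 := sub_ne_zero.2 h2'
    refine mul_ne_zero (mul_ne_zero a1 a2) (mul_ne_zero n1 (sub_ne_zero.2 h4))
  have hpos : 0 < ((u - w) * (v - w) * ((u - z) * (v - z))) *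
      ((m u - m w) * (m v - m w) * ((m u - m z) * (m v - m z))) := by
    calc 0 < ((u - z) * (w - v) * ((m u - m w) * (m z - m v))) ^ 2 := by positivity
      _ = ((u - w) * (z - v) * ((m u - m z) * (m w - m v))) *
          ((u - z) * (w - v) * ((m u - m w) * (m z - m v))) := by rw [c]; ring
      _ = _ := by ring
  exact (pos_iff_pos_of_mul_pos hpos).1 key

/-- A Möbius transformation permuting `-2g, 0, …, 2g - 1` fixes `-2g`, `0` and `2g - 1`. -/
theorem fixes_of_crossRatio {g : ℕ} (hg : 3 ≤ g) {m : ℤ → ℤ}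
    (hm : ∀ n ∈ branchInts g, m n ∈ branchInts g) (hinj : Set.InjOn m (branchInts g))
    (hcr : ∀ r₁ ∈ branchInts g, ∀ r₂ ∈ branchInts g, ∀ r₃ ∈ branchInts g, ∀ r₄ ∈ branchInts g,
      (r₁ - r₂) * (r₃ - r₄) * ((m r₁ - m r₃) * (m r₂ - m r₄)) =
        (r₁ - r₃) * (r₂ - r₄) * ((m r₁ - m r₂) * (m r₃ - m r₄))) :
    m (-(2 * (g : ℤ))) = -(2 * (g : ℤ)) ∧ m 0 = 0 ∧ m (2 * (g : ℤ) - 1) = 2 * (g : ℤ) - 1 := by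
  have hg' : (3 : ℤ) ≤ g := by exact_mod_cast hg
  have hadj {u v : ℤ} (h : CyclicAdj (branchInts g) u v) := (h.map hm hinj hcr).cases hg
  have hne {u v : ℤ} (hu : u ∈ branchInts g) (hv : v ∈ branchInts g) (huv : u ≠ v) :
      m u ≠ m v := fun e => huv (hinj hu hv e)
  have hS (n : ℤ) (h0 : 0 ≤ n) (h1 : n < 2 * (g : ℤ)) : n ∈ branchInts g :=
    mem_branchInts.2 (Or.inr ⟨h0, h1⟩)
  have hS' : -(2 * (g : ℤ)) ∈ branchInts g := mem_branchInts.2 (Or.inl rfl)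
  -- Four consecutive integers have cross ratio `1 : 4`. If the first went to `-2g`, their images
  -- would be `-2g, 0, 1, 2` or `-2g, 2g - 1, 2g - 2, 2g - 3`, which have a different cross ratio.
  have hpath (c₀ c₁ c₂ c₃ : ℤ) (a₁ : CyclicAdj (branchInts g) c₀ c₁)
      (a₂ : CyclicAdj (branchInts g) c₁ c₂) (a₃ : CyclicAdj (branchInts g) c₂ c₃)
      (n₁ : c₀ ≠ c₂) (n₂ : c₀ ≠ c₃) (n₃ : c₁ ≠ c₃)
      (e₁ : (c₀ - c₁) * (c₂ - c₃) = 1) (e₂ : (c₀ - c₂) * (c₁ - c₃) = 4) :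
      m c₀ ≠ -(2 * (g : ℤ)) := by
    intro h
    have c := hcr c₀ a₁.1 c₁ a₁.2.1 c₂ a₂.2.1 c₃ a₃.2.1
    rw [e₁, e₂] at c
    have b₁ := hadj a₁
    have b₂ := hadj a₂
    have b₃ := hadj a₃
    have d₁ := hne a₁.1 a₂.2.1 n₁
    have d₂ := hne a₁.1 a₃.2.1 n₂
    have d₃ := hne a₁.2.1 a₃.2.1 n₃
    have g₁ := mem_branchInts.1 (hm _ a₂.1)
    have g₂ := mem_branchInts.1 (hm _ a₃.1)
    have g₃ := mem_branchInts.1 (hm _ a₃.2.1)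
    rw [h] at b₁ d₁ d₂ c
    have : (m c₁ = 0 ∧ m c₂ = 1 ∧ m c₃ = 2) ∨ (m c₁ = 2 * (g : ℤ) - 1 ∧
        m c₂ = 2 * (g : ℤ) - 2 ∧ m c₃ = 2 * (g : ℤ) - 3) := by omega
    rcases this with ⟨h1, h2, h3⟩ | ⟨h1, h2, h3⟩ <;> rw [h1, h2, h3] at c <;> ring_nf at c <;> omega
  have hfix : m (-(2 * (g : ℤ))) = -(2 * (g : ℤ)) := by
    have hsurj : ∃ i ∈ branchInts g, m i = -(2 * (g : ℤ)) := by
      have : (branchInts g).image m = branchInts g := Finset.eq_of_subset_of_card_le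
        (Finset.image_subset_iff.2 hm) (Finset.card_image_of_injOn hinj).ge
      rw [← this] at hS'
      simpa using hS'
    obtain ⟨i, hi, hmi⟩ := hsurj
    rcases mem_branchInts.1 hi with h | ⟨h0, h1⟩
    · rwa [h] at hmi
    · exfalso
      -- Since `2g ≥ 6`, a path of four consecutive integers starts at `i`, going up or going down.
      by_cases h : i + 3 < 2 * (g : ℤ)
      · refine hpath i (i + 1) (i + 1 + 1) (i + 1 + 1 + 1) (cyclicAdj_succ (by omega) (by omega))
          (cyclicAdj_succ (by omega) (by omega)) (cyclicAdj_succ (by omega) (by omega))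
          (by omega) (by omega) (by omega) (by ring) (by ring) hmi
      · have a (j : ℤ) (h0 : 1 ≤ j) (h1 : j < 2 * (g : ℤ)) : CyclicAdj (branchInts g) j (j - 1) := by
          have := (cyclicAdj_succ (g := g) (u := j - 1) (by omega) (by omega)).symm
          rwa [sub_add_cancel] at this
        refine hpath i (i - 1) (i - 1 - 1) (i - 1 - 1 - 1) (a _ (by omega) (by omega))
          (a _ (by omega) (by omega)) (a _ (by omega) (by omega))
          (by omega) (by omega) (by omega) (by ring) (by ring) hmi
  have b₀ := hadj (cyclicAdj_neg_zero hg)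
  have b₁ := hadj (cyclicAdj_neg_last hg)
  have b₂ := hadj (cyclicAdj_succ (g := g) (u := 0) le_rfl (by omega))
  have d₀ := hne (hS 0 le_rfl (by omega)) (hS (2 * g - 1) (by omega) (by omega)) (by omega)
  have d₁ := hne hS' (hS 1 (by omega) (by omega)) (by omega)
  have c := hcr _ hS' 0 (hS 0 le_rfl (by omega)) 1 (hS 1 (by omega) (by omega)) (2 * g - 1)
    (hS _ (by omega) (by omega))
  rw [hfix] at b₀ b₁ d₁ c
  refine ⟨hfix, ?_⟩
  rw [zero_add] at b₂
  by_contra hcon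
  -- What remains is the reflection of the cycle fixing `-2g`; the cross ratio of `-2g, 0, 1, 2g -
  -- 1` rules it out.
  have h0 : m 0 = 2 * (g : ℤ) - 1 := by omega
  have h1 : m (2 * g - 1) = 0 := by omega
  have g₁ := mem_branchInts.1 (hm _ (hS 1 (by omega) (by omega)))
  have h2 : m 1 = 2 * (g : ℤ) - 2 := by omega
  rw [h0, h1, h2] at c
  have : (2 * (g : ℤ) - 1) * (2 * (g : ℤ) - 2) * (6 * g - 1) = 0 := by linear_combination c
  simp only [mul_eq_zero] at this
  omega

/-- If a Möbius transformation maps `{a, -2g, 0, …, 2g - 1}` into `{b, -2g, 0, …, 2g - 1}`,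
where `a` is irrational and `g ≥ 3`, then `a = b`. -/
theorem eq_of_mobius {g : ℕ} (hg : 3 ≤ g) {a b : ℂ} (ha : a ∉ Set.range (fun q : ℚ => (q : ℂ)))
    {α β γ δ : ℂ} (hD : α * δ - β * γ ≠ 0)
    (h : ∀ r, (r = a ∨ r ∈ excluded g) → ∃ s, (s = b ∨ s ∈ excluded g) ∧
      α * r + β = s * (γ * r + δ)) : a = b := by
  have hirr {p q : ℂ} (hp : ∃ n : ℤ, p = n) (hq : ∃ n : ℤ, q = n) (e : p * a = q) : p = 0 := by
    obtain ⟨n, rfl⟩ := hp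
    obtain ⟨k, rfl⟩ := hq
    by_contra hn
    refine ha ⟨(k : ℚ) / n, ?_⟩
    push_cast
    rw [← e]
    field_simp
  have hane (n : ℤ) : a ≠ n := fun e => ha ⟨n, by simp [e]⟩
  obtain ⟨s₀, hs₀, e₀⟩ := h a (Or.inl rfl)
  -- no three integral branch points and `a` all map to integral points
  have hthree (r₁ r₂ r₃ : ℤ) (n₁₂ : r₁ ≠ r₂) (n₁₃ : r₁ ≠ r₃) (n₂₃ : r₂ ≠ r₃) (s₁ s₂ s₃ s₄ : ℤ)
      (e₁ : α * r₁ + β = s₁ * (γ * r₁ + δ)) (e₂ : α * r₂ + β = s₂ * (γ * r₂ + δ))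
      (e₃ : α * r₃ + β = s₃ * (γ * r₃ + δ)) (e₄ : α * a + β = s₄ * (γ * a + δ)) : False := by
    have c := mobius_crossRatio hD e₁ e₂ e₃ e₄
    set A : ℂ := (r₁ - r₂) * ((s₁ - s₃) * (s₂ - s₄)) with hA
    set B : ℂ := (r₁ - r₃) * ((s₁ - s₂) * (s₃ - s₄)) with hB
    -- The relation `c` reads `A * (r₃ - a) = B * (r₂ - a)`, which is linear in `a` with integral
    -- coefficients, so the coefficient `A - B` of `a` must vanish.
    have hAB : A = B := sub_eq_zero.1 (hirr (q := A * r₃ - B * r₂)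
      ⟨(r₁ - r₂) * ((s₁ - s₃) * (s₂ - s₄)) - (r₁ - r₃) * ((s₁ - s₂) * (s₃ - s₄)), by
        simp [hA, hB]⟩
      ⟨(r₁ - r₂) * ((s₁ - s₃) * (s₂ - s₄)) * r₃ - (r₁ - r₃) * ((s₁ - s₂) * (s₃ - s₄)) * r₂, by
        simp [hA, hB]⟩ (by linear_combination -c))
    have hA0 : A * ((r₂ : ℂ) - r₃) = 0 := by linear_combination (a - r₂) * (-hAB) - c
    have hnA : A ≠ 0 := by
      refine mul_ne_zero (sub_ne_zero.2 (by exact_mod_cast n₁₂)) (mul_ne_zero ?_ ?_)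
      · intro hs
        rw [sub_eq_zero] at hs
        rw [hs] at e₁
        exact n₁₃ (by exact_mod_cast mobius_injective hD e₁ e₃)
      · intro hs
        rw [sub_eq_zero] at hs
        rw [hs] at e₂
        exact hane _ (mobius_injective hD e₂ e₄).symm
    exact hnA ((mul_eq_zero.1 hA0).resolve_right (sub_ne_zero.2 (by exact_mod_cast n₂₃)))
  have hval (n : ℤ) (hn : n ∈ branchInts g) : ∃ s : ℂ, (s = b ∨ ∃ k ∈ branchInts g, s = (k : ℤ)) ∧
      α * n + β = s * (γ * n + δ) := by
    obtain ⟨s, hs, e⟩ := h n (Or.inr (mem_excluded_iff.2 ⟨n, hn, rfl⟩))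
    exact ⟨s, hs.imp_right mem_excluded_iff.1, e⟩
  -- If `a` went to an integer, then, as at most one of `0, 1, 2, 3` can go to `b`, three of them
  -- would go to integers too, against `hthree`.
  have hs₀b : s₀ = b := by
    by_contra hb
    obtain ⟨k₀, -, rfl⟩ := mem_excluded_iff.1 (hs₀.resolve_left hb)
    obtain ⟨t₀, h₀, f₀⟩ := hval 0 (mem_branchInts.2 (by omega))
    obtain ⟨t₁, h₁, f₁⟩ := hval 1 (mem_branchInts.2 (by omega))
    obtain ⟨t₂, h₂, f₂⟩ := hval 2 (mem_branchInts.2 (by omega))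
    obtain ⟨t₃, h₃, f₃⟩ := hval 3 (mem_branchInts.2 (by omega))
    have two {r r' : ℤ} {t t' : ℂ} (f : α * r + β = t * (γ * r + δ))
        (f' : α * r' + β = t' * (γ * r' + δ)) (hne : r ≠ r') (ht : t = b) : t' ≠ b := by
      intro ht'
      rw [ht] at f
      rw [ht'] at f'
      exact hne (by exact_mod_cast mobius_injective hD f f')
    by_cases hb₀ : t₀ = b
    · obtain ⟨k₁, -, rfl⟩ := h₁.resolve_left (two f₀ f₁ (by norm_num) hb₀)
      obtain ⟨k₂, -, rfl⟩ := h₂.resolve_left (two f₀ f₂ (by norm_num) hb₀)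
      obtain ⟨k₃, -, rfl⟩ := h₃.resolve_left (two f₀ f₃ (by norm_num) hb₀)
      exact hthree 1 2 3 (by norm_num) (by norm_num) (by norm_num) _ _ _ _ f₁ f₂ f₃ e₀
    obtain ⟨k₀, -, rfl⟩ := h₀.resolve_left hb₀
    by_cases hb₁ : t₁ = b
    · obtain ⟨k₂, -, rfl⟩ := h₂.resolve_left (two f₁ f₂ (by norm_num) hb₁)
      obtain ⟨k₃, -, rfl⟩ := h₃.resolve_left (two f₁ f₃ (by norm_num) hb₁)
      exact hthree 0 2 3 (by norm_num) (by norm_num) (by norm_num) _ _ _ _ f₀ f₂ f₃ e₀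
    obtain ⟨k₁, -, rfl⟩ := h₁.resolve_left hb₁
    by_cases hb₂ : t₂ = b
    · obtain ⟨k₃, -, rfl⟩ := h₃.resolve_left (two f₂ f₃ (by norm_num) hb₂)
      exact hthree 0 1 3 (by norm_num) (by norm_num) (by norm_num) _ _ _ _ f₀ f₁ f₃ e₀
    obtain ⟨k₂, -, rfl⟩ := h₂.resolve_left hb₂
    exact hthree 0 1 2 (by norm_num) (by norm_num) (by norm_num) _ _ _ _ f₀ f₁ f₂ e₀
  rw [hs₀b] at e₀
  have hval' (n : ℤ) (hn : n ∈ branchInts g) : ∃ k ∈ branchInts g,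
      α * n + β = (k : ℤ) * (γ * n + δ) := by
    obtain ⟨s, hs | ⟨k, hk, rfl⟩, e⟩ := hval n hn
    · rw [hs] at e
      exact absurd (mobius_injective hD e₀ e) (hane n)
    · exact ⟨k, hk, e⟩
  choose! m hm hme using hval'
  have hinj : Set.InjOn m (branchInts g) := by
    intro u hu v hv e
    have hu' := hme u hu
    rw [e] at hu'
    exact_mod_cast mobius_injective hD hu' (hme v hv)
  obtain ⟨h₁, h₂, h₃⟩ := fixes_of_crossRatio hg hm hinj (fun r₁ hr₁ r₂ hr₂ r₃ hr₃ r₄ hr₄ => by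
    exact_mod_cast mobius_crossRatio hD (hme r₁ hr₁) (hme r₂ hr₂) (hme r₃ hr₃) (hme r₄ hr₄))
  have f₁ := hme (-(2 * (g : ℤ))) (mem_branchInts.2 (Or.inl rfl))
  have f₂ := hme 0 (mem_branchInts.2 (by omega))
  have f₃ := hme (2 * (g : ℤ) - 1) (mem_branchInts.2 (by omega))
  rw [h₁] at f₁
  rw [h₂] at f₂
  rw [h₃] at f₃
  -- The factors `2g`, `4g - 1` and `2g - 1` below are the differences of the three fixed points.
  have c := mobius_crossRatio hD f₁ f₂ f₃ e₀
  push_cast at c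
  have hg0 : (g : ℂ) ≠ 0 := by exact_mod_cast (by omega : g ≠ 0)
  have hg1 : (2 * (g : ℂ) - 1) ≠ 0 := by
    rw [sub_ne_zero]; exact_mod_cast (by omega : 2 * g ≠ 1)
  have hg2 : (4 * (g : ℂ) - 1) ≠ 0 := by
    rw [sub_ne_zero]; exact_mod_cast (by omega : 4 * g ≠ 1)
  have : 2 * (g : ℂ) * (4 * (g : ℂ) - 1) * (2 * (g : ℂ) - 1) * (a - b) = 0 := by
    linear_combination c
  exact sub_eq_zero.1 ((mul_eq_zero.1 this).resolve_left
    (mul_ne_zero (mul_ne_zero (mul_ne_zero two_ne_zero hg0) hg2) hg1))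

/-! ### Pairs of generators of a hyperelliptic function field -/

open Polynomial

/-! ### Divisibility for polynomials in one and two variables. -/

/-- Pseudo-division by `G`. -/
theorem exists_C_mul_sub_dvd {R : Type*} [CommRing R] [IsDomain R] {G : R[X]} (hG : G ≠ 0)
    (H : R[X]) : ∃ d : R, d ≠ 0 ∧ ∃ r : R[X], r.degree < G.degree ∧ G ∣ C d * H - r := by
  induction hn : H.natDegree using Nat.strong_induction_on generalizing H with
  | _ n ih =>
  by_cases hlt : H.degree < G.degree
  · exact ⟨1, one_ne_zero, H, hlt, by simp⟩
  rw [not_lt] at hlt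
  have hH : H ≠ 0 := by
    rintro rfl
    rw [degree_zero, le_bot_iff, degree_eq_bot] at hlt
    exact hG hlt
  have hnat : G.natDegree ≤ H.natDegree := natDegree_le_natDegree hlt
  have ha : G.leadingCoeff ≠ 0 := leadingCoeff_ne_zero.2 hG
  set H' := C G.leadingCoeff * H - C H.leadingCoeff * X ^ (H.natDegree - G.natDegree) * G with hH'
  have hdiv (d : R) (r : R[X]) (h : G ∣ C d * H' - r) : G ∣ C (d * G.leadingCoeff) * H - r := by
    have : C (d * G.leadingCoeff) * H - r =
        C d * H' - r + C d * C H.leadingCoeff * X ^ (H.natDegree - G.natDegree) * G := by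
      rw [hH', C_mul]; ring
    rw [this]
    exact dvd_add h (Dvd.intro_left _ rfl)
  have hdeg : H'.degree < H.degree := by
    have h1 : (C G.leadingCoeff * H).degree = H.degree := degree_C_mul ha
    rw [← h1]
    refine degree_sub_lt_left ?_ (mul_ne_zero (C_ne_zero.2 ha) hH) ?_
    · rw [h1, mul_assoc, degree_C_mul (leadingCoeff_ne_zero.2 hH), degree_mul, degree_X_pow,
        degree_eq_natDegree hG, degree_eq_natDegree hH]
      norm_cast
      omega
    · rw [leadingCoeff_mul, leadingCoeff_mul, leadingCoeff_mul, leadingCoeff_C, leadingCoeff_C,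
        leadingCoeff_X_pow]
      ring
  by_cases h0 : H' = 0
  · exact ⟨G.leadingCoeff, ha, 0, by rwa [degree_zero, bot_lt_iff_ne_bot, Ne, degree_eq_bot],
      by simpa using hdiv 1 0 (by simp [h0])⟩
  · obtain ⟨d, hd, r, hr, h⟩ := ih H'.natDegree (hn ▸ natDegree_lt_natDegree h0 hdeg) H' rfl
    exact ⟨d * G.leadingCoeff, mul_ne_zero hd ha, r, hr, hdiv d r h⟩

/-- If `G` is a prime polynomial of least degree in the kernel of `φ : R[X] → L`, then `G` divides
every element of the kernel. -/
theorem dvd_of_map_eq_zero {R L : Type*} [CommRing R] [IsDomain R] [CommRing L]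
    {φ : R[X] →+* L} {G H : R[X]} (hG : Prime G) (hdeg : 0 < G.natDegree) (hφ : φ G = 0)
    (hmin : ∀ r : R[X], r.degree < G.degree → φ r = 0 → r = 0) (hH : φ H = 0) : G ∣ H := by
  obtain ⟨d, hd, r, hr, h⟩ := exists_C_mul_sub_dvd hG.ne_zero H
  have hr0 : r = 0 := by
    refine hmin r hr ?_
    obtain ⟨q, hq⟩ := h
    have := congrArg φ hq
    rw [map_sub, map_mul, map_mul, hH, hφ, mul_zero, zero_mul, zero_sub, neg_eq_zero] at this
    exact this
  rw [hr0, sub_zero] at h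
  refine (hG.dvd_or_dvd h).resolve_left fun h' => ?_
  have := natDegree_le_of_dvd h' (C_ne_zero.2 hd)
  rw [natDegree_C] at this
  omega

/-- Since the target is a domain, some prime factor of `G` is killed. This replaces an explicit
relation between `x` and `x'` by an irreducible one. -/
theorem exists_prime_dvd_map_eq_zero {A L : Type*} [CommRing A] [IsDomain A]
    [UniqueFactorizationMonoid A] [CommRing L] [IsDomain L] (φ : A →+* L) {G : A} (hG : G ≠ 0)
    (h : φ G = 0) : ∃ p, Prime p ∧ p ∣ G ∧ φ p = 0 := by
  obtain ⟨s, hs, u, hu⟩ := UniqueFactorizationMonoid.exists_prime_factors G hG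
  rw [← hu, map_mul, mul_eq_zero, map_multiset_prod, Multiset.prod_eq_zero_iff] at h
  rcases h with h | h
  · obtain ⟨p, hp, hp'⟩ := Multiset.mem_map.1 h
    exact ⟨p, hs p hp, hu ▸ (Multiset.dvd_prod hp).mul_right _, hp'⟩
  · exact absurd h (u.isUnit.map φ).ne_zero

theorem coeff_coeff_swap {R : Type*} [CommRing R] (p : R[X][X]) (i j : ℕ) :
    ((Bivariate.swap p).coeff i).coeff j = (p.coeff j).coeff i := by
  induction p using Polynomial.induction_on' with
  | add p q hp hq => simp [hp, hq]
  | monomial n f =>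
    induction f using Polynomial.induction_on' with
    | add p q hp hq => simp [hp, hq]
    | monomial m r =>
      rw [Bivariate.swap_monomial_monomial]
      simp only [coeff_monomial]
      split_ifs <;> simp_all [coeff_monomial]

/-- Swapping the variables turns the inner degree of `G` into an outer degree. It bounds the degree
in `x` of the irreducible relation by that of a known equation for `x` over `k(x')`. -/
theorem natDegree_coeff_le_of_dvd_swap {R : Type*} [CommRing R] [IsDomain R] {G H : R[X][X]}
    (hH : H ≠ 0) (h : G ∣ Bivariate.swap H) (i : ℕ) : (G.coeff i).natDegree ≤ H.natDegree := by
  have h' : Bivariate.swap G ∣ H := by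
    have := map_dvd (Bivariate.swap (R := R)) h
    rwa [Bivariate.swap_swap_apply] at this
  have hle := natDegree_le_of_dvd h' hH
  rw [natDegree_le_iff_coeff_eq_zero]
  intro N hN
  rw [← coeff_coeff_swap, coeff_eq_zero_of_natDegree_lt (lt_of_le_of_lt hle hN), coeff_zero]

/-- After cancelling the gcd of `u` and `v`, the square of the remaining denominator divides the
squarefree `f`, so it is a unit. -/
theorem dvd_of_squarefree_of_mul_sq_eq {k : Type*} [Field k] {f u v D : k[X]}
    (hf : Squarefree f) (hv : v ≠ 0) (h : f * u ^ 2 = v ^ 2 * D) : f ∣ D := by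
  classical
  have hd : EuclideanDomain.gcd u v ≠ 0 := fun e => hv (EuclideanDomain.gcd_eq_zero_iff.1 e).2
  obtain ⟨u', hu'⟩ := EuclideanDomain.gcd_dvd_left u v
  obtain ⟨v', hv'⟩ := EuclideanDomain.gcd_dvd_right u v
  have hco : IsCoprime u' v' := by
    have h1 := EuclideanDomain.gcd_eq_gcd_ab u v
    refine ⟨EuclideanDomain.gcdA u v, EuclideanDomain.gcdB u v, mul_left_cancel₀ hd ?_⟩
    generalize EuclideanDomain.gcdA u v = s at *
    generalize EuclideanDomain.gcdB u v = t at *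
    generalize EuclideanDomain.gcd u v = d at *
    linear_combination -h1 - s * hu' - t * hv'
  generalize EuclideanDomain.gcd u v = d at *
  have h' : f * u' ^ 2 = v' ^ 2 * D := by
    refine mul_left_cancel₀ (pow_ne_zero 2 hd) ?_
    rw [hu', hv'] at h
    linear_combination h
  have h2 : v' * v' ∣ f := by
    have : v' ^ 2 ∣ f * u' ^ 2 := h' ▸ Dvd.intro _ rfl
    rw [← sq]
    exact (hco.symm.pow (m := 2) (n := 2)).dvd_of_dvd_mul_right this
  have h3 : IsUnit (v' ^ 2) := (hf v' h2).pow 2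
  exact (h3.dvd_mul_left).1 (h' ▸ Dvd.intro _ rfl)

theorem aeval_mem_intermediateField {k L : Type*} [Field k] [Field L] [Algebra k L]
    {F : IntermediateField k L} {x : L} (hx : x ∈ F) (p : k[X]) : aeval x p ∈ F := by
  have := (aeval (⟨x, hx⟩ : F) p).2
  rwa [← IntermediateField.aeval_coe] at this

/-! ### Hyperelliptic pairs and their uniqueness up to Möbius transformations. -/

/-- The elements `x` and `y` generate the field `L` over `k`, with `x` transcendental and `y`
quadratic over `k(x)`, satisfying `y² = f(x)`. -/
structure IsHyperellipticPair {k L : Type*} [Field k] [Field L] [Algebra k L] (f : k[X])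
    (x y : L) : Prop where
  sq_eq : y ^ 2 = aeval x f
  eq_zero : ∀ P Q : k[X], aeval x P + aeval x Q * y = 0 → P = 0 ∧ Q = 0
  exists_repr : ∀ u : L, ∃ P Q R : k[X], R ≠ 0 ∧ u * aeval x R = aeval x P + aeval x Q * y

namespace IsHyperellipticPair

variable {k L : Type*} [Field k] [Field L] [Algebra k L] {f f' : k[X]} {x y x' y' : L}

theorem aeval_eq_zero (h : IsHyperellipticPair f x y) {P : k[X]} (hP : aeval x P = 0) : P = 0 :=
  (h.eq_zero P 0 (by simp [hP])).1

theorem aeval_ne_zero (h : IsHyperellipticPair f x y) {P : k[X]} (hP : P ≠ 0) : aeval x P ≠ 0 :=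
  fun e => hP (h.aeval_eq_zero e)

theorem not_mem_adjoin (h : IsHyperellipticPair f x y) : y ∉ IntermediateField.adjoin k {x} := by
  intro hy
  obtain ⟨r, s, hrs⟩ := (IntermediateField.mem_adjoin_simple_iff k y).1 hy
  by_cases hs : s = 0
  · rw [hs, map_zero, div_zero] at hrs
    exact one_ne_zero (h.eq_zero 0 1 (by simp [hrs])).2
  · have : aeval x (-r) + aeval x s * y = 0 := by
      rw [hrs, mul_div_cancel₀ _ (h.aeval_ne_zero hs), map_neg, neg_add_cancel]
    exact hs (h.eq_zero _ _ this).2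

/-- Otherwise `k(x)` would contain both `x'` and `y'`, hence all of `L`, including `y`. -/
theorem not_mem_adjoin_of_mem (h : IsHyperellipticPair f x y) (h' : IsHyperellipticPair f' x' y')
    (hx : x' ∈ IntermediateField.adjoin k {x}) : y' ∉ IntermediateField.adjoin k {x} := by
  intro hy
  have hF := aeval_mem_intermediateField hx
  obtain ⟨P, Q, R, hR, e⟩ := h'.exists_repr y
  refine h.not_mem_adjoin ?_
  rw [eq_div_of_mul_eq (h'.aeval_ne_zero hR) e]
  exact div_mem (add_mem (hF P) (mul_mem (hF Q) hy)) (hF R)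

/-- The generator `x'` of another hyperelliptic pair lies in `k(x)` if `deg f ≥ 5`. -/
theorem mem_adjoin [CharZero k] (h : IsHyperellipticPair f x y)
    (h' : IsHyperellipticPair f' x' y') (hf : Squarefree f) (hdeg : 5 ≤ f.natDegree) :
    x' ∈ IntermediateField.adjoin k {x} := by
  obtain ⟨P, Q, R, hR, e⟩ := h.exists_repr x'
  by_cases hQ : Q = 0
  · rw [hQ, map_zero, zero_mul, add_zero] at e
    exact (IntermediateField.mem_adjoin_simple_iff k _).2
      ⟨P, R, eq_div_of_mul_eq (h.aeval_ne_zero hR) e⟩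
  exfalso
  obtain ⟨P', Q', R', hR', e'⟩ := h'.exists_repr x
  set φ : k[X][X] →+* L := (aevalAeval (R := k) x x').toRingHom with hφ
  have hφC (p : k[X]) : φ (C p) = aeval x p := by simp [hφ]
  have hφX : φ X = x' := by simp [hφ]
  -- This is `(R X - P)² - Q² f`, the norm of the linear equation for `x' = (P + Q y) / R`.
  set G₀ : k[X][X] := C (R ^ 2) * X ^ 2 + C (-2 * P * R) * X + C (P ^ 2 - Q ^ 2 * f) with hG₀
  have hG₀deg : G₀.natDegree = 2 := natDegree_quadratic (pow_ne_zero 2 hR)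
  have hG₀0 : φ G₀ = 0 := by
    simp only [hG₀, map_add, map_mul, map_pow, hφC, hφX, map_sub, map_neg, map_ofNat]
    linear_combination (x' * aeval x R - aeval x P + aeval x Q * y) * e + (aeval x Q) ^ 2 * h.sq_eq
  obtain ⟨G, hG, hGG₀, hG0⟩ := exists_prime_dvd_map_eq_zero φ
    (fun e0 => by simp [e0] at hG₀deg) hG₀0
  have hG₀ne : G₀ ≠ 0 := fun e0 => by simp [e0] at hG₀deg
  have hGle : G.natDegree ≤ 2 := hG₀deg ▸ natDegree_le_of_dvd hGG₀ hG₀ne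
  have hlow (r : k[X][X]) (hr : r.natDegree ≤ 1) (hr0 : φ r = 0) : r = 0 := by
    obtain ⟨u, v, rfl⟩ := exists_eq_X_add_C_of_natDegree_le_one hr
    simp only [map_add, map_mul, hφC, hφX] at hr0
    have h1 : aeval x (u * P + v * R) + aeval x (u * Q) * y = 0 := by
      simp only [map_add, map_mul]
      linear_combination (aeval x R) * hr0 - (aeval x u) * e
    obtain ⟨h2, h3⟩ := h.eq_zero _ _ h1
    have hu : u = 0 := (mul_eq_zero.1 h3).resolve_right hQ
    rw [hu, zero_mul, zero_add] at h2
    simp [hu, (mul_eq_zero.1 h2).resolve_right hR]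
  have hG2 : G.natDegree = 2 := by
    refine le_antisymm hGle ?_
    by_contra hlt
    exact hG.ne_zero (hlow G (by omega) hG0)
  -- The same equation with the roles of the pairs exchanged: it is quadratic in `x` over `k[x']`.
  set H : k[X][X] := C (R' ^ 2) * X ^ 2 + C (-2 * P' * R') * X + C (P' ^ 2 - Q' ^ 2 * f') with hH
  have hHdeg : H.natDegree = 2 := natDegree_quadratic (pow_ne_zero 2 hR')
  have hHne : H ≠ 0 := fun e0 => by simp [e0] at hHdeg
  have hH0 : φ (Bivariate.swap H) = 0 := by
    change aevalAeval x x' (Bivariate.swap H) = 0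
    rw [Bivariate.aevalAeval_swap]
    simp only [hH, map_add, map_mul, map_pow, map_sub, map_neg, map_ofNat]
    simp
    linear_combination (x * aeval x' R' - aeval x' P' + aeval x' Q' * y') * e' +
      (aeval x' Q') ^ 2 * h'.sq_eq
  have hdvd : G ∣ Bivariate.swap H := by
    refine dvd_of_map_eq_zero hG (by omega) hG0 (fun r hr hr0 => hlow r ?_ hr0) hH0
    by_cases hr00 : r = 0
    · simp [hr00]
    · have := natDegree_lt_natDegree hr00 hr
      omega
  have hcoef (i : ℕ) : (G.coeff i).natDegree ≤ 2 :=
    hHdeg ▸ natDegree_coeff_le_of_dvd_swap hHne hdvd i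
  set a := G.coeff 2
  set b := G.coeff 1
  set c := G.coeff 0
  have ha : a ≠ 0 := by
    have : G.leadingCoeff ≠ 0 := leadingCoeff_ne_zero.2 hG.ne_zero
    rwa [leadingCoeff, hG2] at this
  have hGeq : aeval x a * x' ^ 2 + aeval x b * x' + aeval x c = 0 := by
    have : G = C a * X ^ 2 + C b * X + C c := by
      rw [G.as_sum_range_C_mul_X_pow, hG2]
      simp [Finset.sum_range_succ, a, b, c]
      ring
    rw [← hG0, this]
    simp only [map_add, map_mul, map_pow, hφC, hφX]
  -- Completing the square: `(2aP + bR) + 2aQ y = R (2a x' + b)`, whose square is `R² (b² - 4ac)`.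
  -- The coefficient of `y` must vanish, which makes the discriminant `f` up to squares.
  have key : aeval x ((2 * a * P + b * R) ^ 2 + 4 * a ^ 2 * Q ^ 2 * f - R ^ 2 * (b ^ 2 - 4 * a * c))
      + aeval x (2 * (2 * a * P + b * R) * (2 * a * Q)) * y = 0 := by
    simp only [map_add, map_mul, map_pow, map_sub, map_ofNat]
    have hsq := h.sq_eq
    generalize aeval x a = a at *
    generalize aeval x b = b at *
    generalize aeval x c = c at *
    generalize aeval x P = P at *
    generalize aeval x Q = Q at *
    generalize aeval x R = R at *
    generalize aeval x f = f at *
    have e1 : P = x' * R - Q * y := by linear_combination -e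
    subst e1
    linear_combination 4 * a * R ^ 2 * hGeq - 4 * a ^ 2 * Q ^ 2 * hsq
  obtain ⟨k1, k2⟩ := h.eq_zero _ _ key
  have hz : 2 * a * P + b * R = 0 := by
    have h2 : (2 : k[X]) ≠ 0 := two_ne_zero
    simpa [h2, ha, hQ] using k2
  rw [hz] at k1
  have hdisc : f * (2 * a * Q) ^ 2 = R ^ 2 * (b ^ 2 - 4 * a * c) := by linear_combination k1
  have hfd := dvd_of_squarefree_of_mul_sq_eq hf hR hdisc
  have hdne : b ^ 2 - 4 * a * c ≠ 0 := by
    intro e0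
    rw [e0, mul_zero] at hdisc
    have hfne : f ≠ 0 := hf.ne_zero
    simp [hfne, ha, hQ] at hdisc
  have h4 : (b ^ 2 - 4 * a * c).natDegree ≤ 4 := by
    have e4 : (4 : k[X]) = C 4 := (map_ofNat C 4).symm
    rw [e4]
    refine (natDegree_sub_le _ _).trans (max_le ?_ ?_)
    · exact natDegree_pow_le.trans (by have : b.natDegree ≤ 2 := hcoef 1; omega)
    · refine natDegree_mul_le.trans ?_
      have h1 := natDegree_C_mul_le (4 : k) a
      have h2 : a.natDegree ≤ 2 := hcoef 2
      have h3 : c.natDegree ≤ 2 := hcoef 0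
      omega
  have := natDegree_le_of_dvd hfd hdne
  omega

/-- Two hyperelliptic pairs of generators of the same field are related by a Möbius
transformation that maps the roots of `f` to roots of `f'`. -/
theorem exists_mobius [CharZero k] {T : Finset k} (hT : Even T.card)
    (h : IsHyperellipticPair f x y) (h' : IsHyperellipticPair (∏ s ∈ T, (X - C s)) x' y')
    (hf : Squarefree f) (hdeg : 5 ≤ f.natDegree) :
    ∃ α β γ δ : k, α * δ - β * γ ≠ 0 ∧
      ∀ r, f.IsRoot r → ∃ s ∈ T, α * r + β = s * (γ * r + δ) := by
  have hx := h.mem_adjoin h' hf hdeg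
  have hy := h.not_mem_adjoin_of_mem h' hx
  obtain ⟨P, R, e⟩ := (IntermediateField.mem_adjoin_simple_iff k _).1 hx
  have hF := aeval_mem_intermediateField hx
  have hR : R ≠ 0 := by
    rintro rfl
    rw [map_zero, div_zero] at e
    have := h'.aeval_eq_zero (P := X) (by simp [e])
    exact X_ne_zero this
  have e : x' * aeval x R = aeval x P := by
    rw [e, div_mul_cancel₀ _ (h.aeval_ne_zero hR)]
  obtain ⟨P', Q', R', hR', e'⟩ := h'.exists_repr x
  have hQ' : Q' = 0 := by
    by_contra hQ'
    refine hy ?_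
    have : y' = (x * aeval x' R' - aeval x' P') / aeval x' Q' := by
      rw [eq_div_iff (h'.aeval_ne_zero hQ')]
      linear_combination -e'
    rw [this]
    exact div_mem (sub_mem (mul_mem (IntermediateField.mem_adjoin_simple_self k x) (hF _)) (hF _))
      (hF _)
  rw [hQ', map_zero, zero_mul, add_zero] at e'
  set φ : k[X][X] →+* L := (aevalAeval (R := k) x x').toRingHom with hφ
  have hφC (p : k[X]) : φ (C p) = aeval x p := by simp [hφ]
  have hφX : φ X = x' := by simp [hφ]
  set G₀ : k[X][X] := C R * X + C (-P) with hG₀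
  have hG₀deg : G₀.natDegree = 1 := natDegree_linear hR
  have hG₀ne : G₀ ≠ 0 := fun e0 => by simp [e0] at hG₀deg
  have hG₀0 : φ G₀ = 0 := by
    simp only [hG₀, map_add, map_mul, hφC, hφX, map_neg]
    linear_combination e
  obtain ⟨G, hG, hGG₀, hG0⟩ := exists_prime_dvd_map_eq_zero φ hG₀ne hG₀0
  have hGle : G.natDegree ≤ 1 := hG₀deg ▸ natDegree_le_of_dvd hGG₀ hG₀ne
  have hlow (r : k[X][X]) (hr : r.natDegree = 0) (hr0 : φ r = 0) : r = 0 := by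
    rw [natDegree_eq_zero] at hr
    obtain ⟨u, rfl⟩ := hr
    rw [hφC] at hr0
    rw [h.aeval_eq_zero hr0, C_0]
  have hG1 : G.natDegree = 1 := by
    refine le_antisymm hGle ?_
    by_contra hlt
    exact hG.ne_zero (hlow G (by omega) hG0)
  set H : k[X][X] := C R' * X + C (-P') with hH
  have hHdeg : H.natDegree = 1 := natDegree_linear hR'
  have hHne : H ≠ 0 := fun e0 => by simp [e0] at hHdeg
  have hH0 : φ (Bivariate.swap H) = 0 := by
    change aevalAeval x x' (Bivariate.swap H) = 0
    rw [Bivariate.aevalAeval_swap]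
    simp only [hH, map_add, map_mul, map_neg]
    simp
    linear_combination e'
  have hdvd : G ∣ Bivariate.swap H := by
    refine dvd_of_map_eq_zero hG (by omega) hG0 (fun r hr hr0 => hlow r ?_ hr0) hH0
    by_cases hr00 : r = 0
    · simp [hr00]
    · have := natDegree_lt_natDegree hr00 hr
      omega
  have hcoef (i : ℕ) : (G.coeff i).natDegree ≤ 1 :=
    hHdeg ▸ natDegree_coeff_le_of_dvd_swap hHne hdvd i
  obtain ⟨γ, δ, ha'⟩ := exists_eq_X_add_C_of_natDegree_le_one (hcoef 1)
  obtain ⟨b₁, b₀, hb'⟩ := exists_eq_X_add_C_of_natDegree_le_one (hcoef 0)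
  set a := G.coeff 1
  set b := G.coeff 0
  have ha : a ≠ 0 := by
    have : G.leadingCoeff ≠ 0 := leadingCoeff_ne_zero.2 hG.ne_zero
    rwa [leadingCoeff, hG1] at this
  have hGeq : aeval x a * x' + aeval x b = 0 := by
    have : G = C a * X + C b := by
      rw [G.as_sum_range_C_mul_X_pow, hG1]
      simp [Finset.sum_range_succ, a, b]
      ring
    rw [← hG0, this]
    simp only [map_add, map_mul, hφC, hφX]
  -- The relation is now `(γ x + δ) x' + (b₁ x + b₀) = 0`. If the determinant were zero, `a` and `b`
  -- would be proportional over `k` and `x'` would be algebraic.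
  refine ⟨-b₁, -b₀, γ, δ, ?_, ?_⟩
  · intro hdet
    have hlin (u v : k) (huv : C u * b = C v * a) (hu : u ≠ 0) : False := by
      have h1 : aeval x a * aeval x' (C u * X + C v) = 0 := by
        have := congrArg (aeval x) huv
        simp only [map_mul, map_add, aeval_C, aeval_X] at this ⊢
        linear_combination (algebraMap k L u) * hGeq - this
      have h2 := h'.aeval_eq_zero ((mul_eq_zero.1 h1).resolve_left (h.aeval_ne_zero ha))
      have := congrArg (fun p => coeff p 1) h2
      simp at this
      exact hu this
    have hC : C b₁ * C δ = C b₀ * C γ := by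
      rw [← C_mul, ← C_mul]
      congr 1
      linear_combination -hdet
    by_cases hγ : γ = 0
    · by_cases hδ : δ = 0
      · exact ha (by rw [ha', hγ, hδ]; simp)
      · refine hlin δ b₀ ?_ hδ
        rw [ha', hb']
        linear_combination X * hC
    · refine hlin γ b₁ ?_ hγ
      rw [ha', hb']
      linear_combination -hC
  · obtain ⟨n, hn⟩ := hT
    obtain ⟨P₂, Q₂, S, hS, e₂⟩ := h.exists_repr y'
    -- `D` is `f'(-b / a)` with denominators cleared. As `T` has `2n` elements, the factor needed is
    -- the square of `a ^ n`, so `D` is a square times `y'²`.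
    set D : k[X] := ∏ s ∈ T, (-b - C s * a) with hD
    have hDx : (aeval x a ^ n) ^ 2 * y' ^ 2 = aeval x D := by
      rw [h'.sq_eq, hD, map_prod, map_prod, ← pow_mul, mul_two, ← hn, ← Finset.prod_const,
        ← Finset.prod_mul_distrib]
      refine Finset.prod_congr rfl fun s _ => ?_
      simp only [map_sub, map_neg, map_mul, aeval_X, aeval_C]
      linear_combination hGeq
    have key : aeval x ((a ^ n) ^ 2 * (P₂ ^ 2 + Q₂ ^ 2 * f) - S ^ 2 * D) +
        aeval x ((a ^ n) ^ 2 * (2 * P₂ * Q₂)) * y = 0 := by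
      simp only [map_add, map_mul, map_pow, map_sub, map_ofNat]
      rw [← hDx]
      linear_combination (-(aeval x a ^ n) ^ 2) * (aeval x Q₂ ^ 2 * h.sq_eq +
        (y' * aeval x S + (aeval x P₂ + aeval x Q₂ * y)) * e₂)
    obtain ⟨k1, k2⟩ := h.eq_zero _ _ key
    -- Since `y'` is not in `k(x)` but its square is, `y'` is a rational function of `x` times `y`.
    -- Hence `D` is `f` up to squares, and `f` divides it.
    have hQ₂ : Q₂ ≠ 0 := by
      rintro rfl
      refine hy ((IntermediateField.mem_adjoin_simple_iff k _).2
        ⟨P₂, S, eq_div_of_mul_eq (h.aeval_ne_zero hS) ?_⟩)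
      simpa using e₂
    have hP₂ : P₂ = 0 := by
      simpa [ha, hQ₂] using k2
    have hfD : f ∣ D := dvd_of_squarefree_of_mul_sq_eq (u := a ^ n * Q₂) hf hS (by
      rw [hP₂] at k1
      linear_combination k1)
    intro r hr
    have hDr : D.eval r = 0 := hr.dvd hfD
    rw [hD, eval_prod, Finset.prod_eq_zero_iff] at hDr
    obtain ⟨s, hs, hs'⟩ := hDr
    refine ⟨s, hs, ?_⟩
    rw [ha', hb'] at hs'
    simp at hs'
    linear_combination hs'

end IsHyperellipticPair

/-! ### The branch points and the affine equation -/

open Classical in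
/-- The parameter `a` together with `-2g, 0, …, 2g - 1`. -/
noncomputable def branchPoints (g : ℕ) (a : ℂ) : Finset ℂ :=
  insert a ((branchInts g).image (Int.cast : ℤ → ℂ))

theorem mem_branchPoints {g : ℕ} {a c : ℂ} : c ∈ branchPoints g a ↔ c = a ∨ c ∈ excluded g := by
  simp only [branchPoints, Finset.mem_insert, Finset.mem_image, mem_excluded_iff, eq_comm]

theorem prod_branchPoints {M : Type*} [CommMonoid M] {g : ℕ} {a : ℂ} (ha : a ∉ excluded g)
    (φ : ℂ → M) : ∏ s ∈ branchPoints g a, φ s =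
      φ a * φ (-(2 * (g : ℂ))) * ∏ i ∈ Finset.range (2 * g), φ i := by
  classical
  have h1 : a ∉ (branchInts g).image (Int.cast : ℤ → ℂ) := by
    intro h
    obtain ⟨n, hn, e⟩ := Finset.mem_image.1 h
    exact ha (mem_excluded_iff.2 ⟨n, hn, e.symm⟩)
  have h2 : Finset.Ico 0 (2 * (g : ℤ)) = (Finset.range (2 * g)).image (Nat.cast : ℕ → ℤ) := by
    ext n
    simp only [Finset.mem_Ico, Finset.mem_image, Finset.mem_range]
    constructor
    · exact fun h => ⟨n.toNat, by omega, by omega⟩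
    · rintro ⟨m, h, rfl⟩; omega
  rw [branchPoints, Finset.prod_insert h1, Finset.prod_image (by simp), branchInts,
    Finset.prod_insert (by simp; omega), h2, Finset.prod_image (by simp), mul_assoc]
  push_cast
  simp

theorem card_branchPoints {g : ℕ} {a : ℂ} (ha : a ∉ excluded g) :
    (branchPoints g a).card = 2 * (g + 1) := by
  classical
  -- Counting is the product formula for a constant function with values in `Multiplicative ℕ`.
  have h := prod_branchPoints (M := Multiplicative ℕ) ha (fun _ => Multiplicative.ofAdd 1)
  rw [Finset.prod_const, Finset.prod_const, Finset.card_range] at h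
  have h' := congrArg Multiplicative.toAdd h
  simp at h'
  omega

/-- The polynomial `(x - a) (x + 2g) ∏ (x - i)`. -/
noncomputable def affinePoly (g : ℕ) (a : ℂ) : ℂ[X] := ∏ s ∈ branchPoints g a, (X - C s)

theorem affinePoly_squarefree (g : ℕ) (a : ℂ) : Squarefree (affinePoly g a) :=
  (separable_prod_X_sub_C_iff'.2 fun _ _ _ _ h => h).squarefree

theorem natDegree_affinePoly {g : ℕ} {a : ℂ} (ha : a ∉ excluded g) :
    (affinePoly g a).natDegree = 2 * (g + 1) := by
  rw [affinePoly, natDegree_prod_of_monic _ _ (fun s _ => monic_X_sub_C s)]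
  simp [card_branchPoints ha]

theorem isRoot_affinePoly {g : ℕ} {a r : ℂ} (hr : r ∈ branchPoints g a) :
    (affinePoly g a).IsRoot r := by
  rw [IsRoot, affinePoly, eval_prod]
  exact Finset.prod_eq_zero hr (by simp)

/-! ### The homogeneous coordinate ring is a domain -/

/-- The class of a polynomial in the homogeneous coordinate ring. -/
noncomputable abbrev coordMk (g : ℕ) (a : ℂ) : MvPolynomial (Fin 3) ℂ →ₐ[ℂ] CoordRing g a :=
  Ideal.Quotient.mkₐ ℂ _

theorem equation_eq {g : ℕ} {a : ℂ} (ha : a ∉ excluded g) : equation g a =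
    MvPolynomial.X 2 ^ 2 -
      ∏ s ∈ branchPoints g a, (MvPolynomial.X 0 - MvPolynomial.C s * MvPolynomial.X 1) := by
  rw [prod_branchPoints ha, equation, MvPolynomial.C_neg, neg_mul, sub_neg_eq_add]

theorem coordMk_sq {g : ℕ} {a : ℂ} (ha : a ∉ excluded g) :
    coordMk g a (MvPolynomial.X 2) ^ 2 = ∏ s ∈ branchPoints g a,
      (coordMk g a (MvPolynomial.X 0) -
        algebraMap ℂ (CoordRing g a) s * coordMk g a (MvPolynomial.X 1)) := by
  have h : coordMk g a (equation g a) = 0 :=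
    Ideal.Quotient.eq_zero_iff_mem.2 (Ideal.mem_span_singleton_self _)
  have h' := congrArg (coordMk g a) (equation_eq ha)
  rw [h, map_sub, map_pow, map_prod] at h'
  refine (sub_eq_zero.1 h'.symm).trans (Finset.prod_congr rfl fun s _ => ?_)
  rw [map_sub, map_mul, ← MvPolynomial.algebraMap_eq, AlgHom.commutes]

/-- A ring homomorphism from the homogeneous coordinate ring, given by the images of
`ℂ`, `z`, `t` and `w`. -/
noncomputable def coordLift {S : Type*} [CommRing S] {g : ℕ} {a : ℂ} (ha : a ∉ excluded g)
    (i : ℂ →+* S) (z t w : S) (h : w ^ 2 = ∏ s ∈ branchPoints g a, (z - i s * t)) :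
    CoordRing g a →+* S :=
  Ideal.Quotient.lift _ (MvPolynomial.eval₂Hom i ![z, t, w]) (by
    intro p hp
    obtain ⟨q, rfl⟩ := Ideal.mem_span_singleton.1 hp
    rw [map_mul, equation_eq ha]
    simp [h])

theorem coordLift_mk {S : Type*} [CommRing S] {g : ℕ} {a : ℂ} (ha : a ∉ excluded g)
    (i : ℂ →+* S) (z t w : S) (h : w ^ 2 = ∏ s ∈ branchPoints g a, (z - i s * t))
    (p : MvPolynomial (Fin 3) ℂ) :
    coordLift ha i z t w h (coordMk g a p) = MvPolynomial.eval₂Hom i ![z, t, w] p := rfl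

/-- The binary form `∏ (z - s t)` as a polynomial in `z` over `ℂ[t]`. -/
noncomputable def binaryForm (g : ℕ) (a : ℂ) : ℂ[X][X] :=
  ∏ s ∈ branchPoints g a, (X - C (C s * X))

/-- Eisenstein's criterion at the prime `z - a t`, which divides the binary form exactly once. -/
theorem irreducible_sq_sub_binaryForm (g : ℕ) (a : ℂ) :
    Irreducible (X ^ 2 - C (binaryForm g a) : ℂ[X][X][X]) := by
  classical
  have hmem : a ∈ branchPoints g a := mem_branchPoints.2 (Or.inl rfl)
  set l : ℂ[X][X] := X - C (C a * X) with hl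
  have hlp : Prime l := prime_X_sub_C _
  have hF : binaryForm g a = l * ∏ s ∈ (branchPoints g a).erase a, (X - C (C s * X)) :=
    (Finset.mul_prod_erase _ _ hmem).symm
  have hmonic : (X ^ 2 - C (binaryForm g a) : ℂ[X][X][X]).Monic :=
    monic_X_pow_sub_C _ two_ne_zero
  have hnat : (X ^ 2 - C (binaryForm g a) : ℂ[X][X][X]).natDegree = 2 :=
    natDegree_X_pow_sub_C
  have hc0 : (X ^ 2 - C (binaryForm g a) : ℂ[X][X][X]).coeff 0 = -binaryForm g a := by
    rw [coeff_sub, coeff_C_zero, coeff_X_pow]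
    simp
  refine irreducible_of_eisenstein_criterion (P := Ideal.span {l})
    ((Ideal.span_singleton_prime hlp.ne_zero).2 hlp) ?_ ?_ ?_ ?_ hmonic.isPrimitive
  · rw [hmonic.leadingCoeff, Ideal.mem_span_singleton]
    exact fun h => hlp.not_isUnit (isUnit_of_dvd_one h)
  · intro n hn
    rw [Ideal.mem_span_singleton]
    have hn2 : n < 2 := by
      rw [degree_eq_natDegree hmonic.ne_zero, hnat] at hn
      exact_mod_cast hn
    interval_cases n
    · rw [hc0, hF]
      exact dvd_neg.2 (Dvd.intro _ rfl)
    · simp [coeff_X_pow]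
  · rw [degree_eq_natDegree hmonic.ne_zero, hnat]
    norm_num
  · intro h
    rw [Ideal.span_singleton_pow, Ideal.mem_span_singleton, hc0] at h
    replace h : l ^ 2 ∣ binaryForm g a := by
      obtain ⟨q, hq⟩ := h
      exact ⟨-q, by linear_combination -hq⟩
    rw [hF, sq] at h
    have h3 := (mul_dvd_mul_iff_left hlp.ne_zero).1 h
    rw [hl, dvd_iff_isRoot, IsRoot, eval_prod, Finset.prod_eq_zero_iff] at h3
    obtain ⟨s, hs, hs'⟩ := h3
    rw [eval_sub, eval_X, eval_C, ← sub_mul, ← C_sub, mul_eq_zero, C_eq_zero, sub_eq_zero] at hs'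
    rcases hs' with h | h
    · exact Finset.ne_of_mem_erase hs h.symm
    · exact X_ne_zero h

/-- The ring embeds in `ℂ[t][z][w] / (w² - F)`, a domain because `w² - F` is prime; a left inverse
suffices for injectivity. -/
theorem isDomain_coordRing {g : ℕ} {a : ℂ} (ha : a ∉ excluded g) : IsDomain (CoordRing g a) := by
  set E : ℂ[X][X][X] := X ^ 2 - C (binaryForm g a) with hE
  have hprime : Prime E := (irreducible_sq_sub_binaryForm g a).prime
  have : IsDomain (AdjoinRoot E) := AdjoinRoot.isDomain_of_prime hprime
  have hroot : AdjoinRoot.root E ^ 2 = AdjoinRoot.of E (binaryForm g a) := by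
    have := AdjoinRoot.eval₂_root E
    rw [hE] at this
    simpa [sub_eq_zero] using this
  let i : ℂ →+* AdjoinRoot E := (AdjoinRoot.of E).comp (C.comp C)
  let φ : CoordRing g a →+* AdjoinRoot E := coordLift ha i (AdjoinRoot.of E X)
    (AdjoinRoot.of E (C X)) (AdjoinRoot.root E) (by
      rw [hroot, binaryForm, map_prod]
      simp [i])
  let z : CoordRing g a := coordMk g a (MvPolynomial.X 0)
  let t : CoordRing g a := coordMk g a (MvPolynomial.X 1)
  let w : CoordRing g a := coordMk g a (MvPolynomial.X 2)
  let j : ℂ[X][X] →+* CoordRing g a := eval₂RingHom (aeval t).toRingHom z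
  have hw : w ^ 2 = j (binaryForm g a) := by
    rw [binaryForm, map_prod, coordMk_sq ha]
    refine Finset.prod_congr rfl fun s _ => ?_
    simp [j, z, t]
  let ψ : AdjoinRoot E →+* CoordRing g a := AdjoinRoot.lift j w (by simp [hE, hw])
  have hid : ψ.comp φ = RingHom.id _ := by
    refine Ideal.Quotient.ringHom_ext (MvPolynomial.ringHom_ext (fun c => ?_) fun n => ?_)
    · change ψ (φ (coordMk g a (MvPolynomial.C c))) = coordMk g a (MvPolynomial.C c)
      rw [coordLift_mk]
      simp [ψ, i, j]
    · change ψ (φ (coordMk g a (MvPolynomial.X n))) = coordMk g a (MvPolynomial.X n)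
      rw [coordLift_mk]
      fin_cases n <;> simp [ψ, j, z, t, w]
  exact Function.Injective.isDomain φ
    (Function.LeftInverse.injective (g := ψ) fun u => congrArg (fun h => h u) hid)

/-! ### The affine coordinate ring -/

/-- Multiplying by the conjugate `R - S y` turns a denominator `R + S y` into the norm `R² - S² f`,
a polynomial in `x`. -/
theorem isHyperellipticPair_of_isFractionRing {k N L : Type*} [Field k] [CommRing N] [IsDomain N]
    [Field L] [Algebra k N] [Algebra N L] [Algebra k L] [IsScalarTower k N L] [IsFractionRing N L]
    {f : k[X]} {x y : N} (hsq : y ^ 2 = aeval x f)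
    (hind : ∀ P Q : k[X], aeval x P + aeval x Q * y = 0 → P = 0 ∧ Q = 0)
    (hrepr : ∀ n : N, ∃ P Q : k[X], n = aeval x P + aeval x Q * y) :
    IsHyperellipticPair f (algebraMap N L x) (algebraMap N L y) where
  sq_eq := by rw [← map_pow, hsq, aeval_algebraMap_apply]
  eq_zero P Q h := by
    refine hind P Q (IsFractionRing.injective N L ?_)
    rw [map_zero, map_add, map_mul, ← aeval_algebraMap_apply, ← aeval_algebraMap_apply, h]
  exists_repr u := by
    obtain ⟨n, d, hd, rfl⟩ := IsFractionRing.div_surjective (A := N) u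
    have hd0 : d ≠ 0 := nonZeroDivisors.ne_zero hd
    obtain ⟨P, Q, rfl⟩ := hrepr n
    obtain ⟨R, S, rfl⟩ := hrepr d
    have hconj : aeval x R - aeval x S * y ≠ 0 := by
      intro h
      obtain ⟨h1, h2⟩ := hind R (-S) (by rw [map_neg]; linear_combination h)
      exact hd0 (by simp [h1, neg_eq_zero.1 h2])
    have hnorm : aeval x (R ^ 2 - S ^ 2 * f) =
        (aeval x R + aeval x S * y) * (aeval x R - aeval x S * y) := by
      simp only [map_sub, map_mul, map_pow]
      linear_combination (aeval x S) ^ 2 * hsq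
    refine ⟨P * R - Q * S * f, Q * R - P * S, R ^ 2 - S ^ 2 * f, fun h => ?_, ?_⟩
    · rw [h, map_zero] at hnorm
      exact mul_ne_zero hd0 hconj hnorm.symm
    · rw [aeval_algebraMap_apply, aeval_algebraMap_apply, aeval_algebraMap_apply, hnorm, map_mul,
        ← mul_assoc, div_mul_cancel₀ _ (by
          rw [Ne, map_eq_zero_iff _ (IsFractionRing.injective N L)]; exact hd0),
        ← map_mul, ← map_mul, ← map_add]
      congr 1
      simp only [map_sub, map_mul]
      linear_combination (-aeval x Q * aeval x S) * hsq

/-! ### The chart `t ≠ 0` of the curve. -/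

open HomogeneousLocalization

theorem coordMk_mem {g : ℕ} {a : ℂ} {n : ℕ} {p : MvPolynomial (Fin 3) ℂ}
    (hp : p.IsWeightedHomogeneous (weights g) n) : coordMk g a p ∈ coordGrading g a n :=
  mk_mem_quotientGrading _ _ hp

/-- The class of `t` in the homogeneous coordinate ring. -/
noncomputable abbrev coordT (g : ℕ) (a : ℂ) : CoordRing g a := coordMk g a (MvPolynomial.X 1)

theorem coordT_mem (g : ℕ) (a : ℂ) : coordT g a ∈ coordGrading g a 1 :=
  coordMk_mem (MvPolynomial.isWeightedHomogeneous_X ℂ (weights g) 1)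

/-- The coordinate ring of the affine chart `t ≠ 0`. -/
abbrev AffineChart (g : ℕ) (a : ℂ) : Type := Away (coordGrading g a) (coordT g a)

/-- Scalars enter through the degree 0 part, as in the structure morphism of `curve`; this is what
`chartι_hom` compares. -/
noncomputable instance (g : ℕ) (a : ℂ) : Algebra ℂ (AffineChart g a) where
  algebraMap := (fromZeroRingHom (coordGrading g a) (Submonoid.powers (coordT g a))).comp
    (algebraMap ℂ (coordGrading g a 0))
  commutes' _ _ := mul_comm _ _
  smul_def' c n := by
    refine HomogeneousLocalization.val_injective _ ?_
    rw [val_smul, val_mul, Algebra.smul_def, IsScalarTower.algebraMap_apply ℂ (CoordRing g a)]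
    exact congrArg (· * n.val)
      (Localization.mk_one_eq_algebraMap (M := Submonoid.powers (coordT g a)) _).symm

/-- The coordinate function `x = z / t`. -/
noncomputable def chartX (g : ℕ) (a : ℂ) : AffineChart g a :=
  Away.mk _ (coordT_mem g a) 1 (coordMk g a (MvPolynomial.X 0))
    (coordMk_mem (MvPolynomial.isWeightedHomogeneous_X ℂ (weights g) 0))

/-- The coordinate function `y = w / t ^ (g + 1)`. -/
noncomputable def chartY (g : ℕ) (a : ℂ) : AffineChart g a :=
  Away.mk _ (coordT_mem g a) (g + 1) (coordMk g a (MvPolynomial.X 2))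
    (coordMk_mem (by
      rw [smul_eq_mul, mul_one]
      exact MvPolynomial.isWeightedHomogeneous_X ℂ (weights g) 2))

theorem val_awayMk_mul {ι A σ : Type*} [CommRing A] [SetLike σ A] [AddSubgroupClass σ A]
    [AddCommMonoid ι] [DecidableEq ι] (𝒜 : ι → σ) [GradedRing 𝒜] {f : A} {d : ι} (hf : f ∈ 𝒜 d)
    (n : ℕ) (u : A) (hu : u ∈ 𝒜 (n • d)) :
    (Away.mk 𝒜 hf n u hu).val * algebraMap A (Localization.Away f) f ^ n =
      algebraMap A (Localization.Away f) u := by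
  rw [Away.val_mk, Localization.mk_eq_mk', ← map_pow]
  exact IsLocalization.mk'_spec (M := Submonoid.powers f) (Localization.Away f) u ⟨f ^ n, n, rfl⟩

section

variable (g : ℕ) (a : ℂ)

/-- The inclusion of the coordinate ring of the chart into the localization. -/
noncomputable abbrev chartVal : AffineChart g a →+* Localization.Away (coordT g a) :=
  algebraMap _ _

theorem chartVal_injective : Function.Injective (chartVal g a) :=
  HomogeneousLocalization.val_injective _

theorem chartVal_algebraMap (c : ℂ) : chartVal g a (algebraMap ℂ (AffineChart g a) c) =
    algebraMap (CoordRing g a) _ (algebraMap ℂ (CoordRing g a) c) :=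
  Localization.mk_one_eq_algebraMap (M := Submonoid.powers (coordT g a)) _

theorem chartVal_chartX : chartVal g a (chartX g a) * algebraMap _ _ (coordT g a) =
    algebraMap (CoordRing g a) _ (coordMk g a (MvPolynomial.X 0)) := by
  have := val_awayMk_mul (coordGrading g a) (coordT_mem g a) 1 (coordMk g a (MvPolynomial.X 0))
    (coordMk_mem (MvPolynomial.isWeightedHomogeneous_X ℂ (weights g) 0))
  rwa [pow_one] at this

theorem chartVal_chartY : chartVal g a (chartY g a) * algebraMap _ _ (coordT g a) ^ (g + 1) =
    algebraMap (CoordRing g a) _ (coordMk g a (MvPolynomial.X 2)) :=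
  val_awayMk_mul (coordGrading g a) (coordT_mem g a) (g + 1) _ _

end

theorem isUnit_coordT (g : ℕ) (a : ℂ) :
    IsUnit (algebraMap (CoordRing g a) (Localization.Away (coordT g a)) (coordT g a)) :=
  IsLocalization.Away.algebraMap_isUnit _

theorem chartY_sq {g : ℕ} {a : ℂ} (ha : a ∉ excluded g) :
    chartY g a ^ 2 = aeval (chartX g a) (affinePoly g a) := by
  refine chartVal_injective g a (((isUnit_coordT g a).pow (2 * (g + 1))).mul_right_cancel ?_)
  have h := congrArg (algebraMap (CoordRing g a) (Localization.Away (coordT g a))) (coordMk_sq ha)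
  rw [map_pow, ← chartVal_chartY, map_prod] at h
  rw [map_pow, affinePoly, map_prod, map_prod]
  -- The exponent of `t` is the number of branch points, so each linear factor receives one `t`.
  nth_rw 2 [← card_branchPoints ha]
  rw [← Finset.prod_const, ← Finset.prod_mul_distrib]
  calc _ = _ := by ring
    _ = _ := h
    _ = _ := Finset.prod_congr rfl fun s _ => ?_
  rw [map_sub, map_mul, ← chartVal_chartX, map_sub, aeval_X, aeval_C, map_sub,
    chartVal_algebraMap, sub_mul]

/-- Dehomogenisation: every monomial of weight `n` contributes `τ ^ n`. -/
theorem eval₂_weightedHomogeneous {R S : Type*} [CommRing R] [CommRing S] (i : R →+* S)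
    {g n : ℕ} {p : MvPolynomial (Fin 3) R} (hp : p.IsWeightedHomogeneous (weights g) n)
    (x y τ : S) : MvPolynomial.eval₂Hom i ![x * τ, τ, y * τ ^ (g + 1)] p =
      MvPolynomial.eval₂Hom i ![x, 1, y] p * τ ^ n := by
  simp only [MvPolynomial.coe_eval₂Hom, MvPolynomial.eval₂_eq', Finset.sum_mul]
  refine Finset.sum_congr rfl fun d hd => ?_
  have hw := hp (MvPolynomial.mem_support_iff.1 hd)
  rw [Finsupp.weight_apply, Finsupp.sum_fintype _ _ (by simp)] at hw
  simp only [Fin.sum_univ_three, weights, Matrix.cons_val, smul_eq_mul, mul_one] at hw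
  simp only [Fin.prod_univ_three, Matrix.cons_val, one_pow, mul_one]
  rw [← hw]
  ring

theorem exists_eq_add_mul_of_sq_eq {k N : Type*} [CommRing k] [CommRing N] [Algebra k N] {f : k[X]}
    {x y : N} (h : y ^ 2 = aeval x f) (p : MvPolynomial (Fin 3) k) :
    ∃ P Q : k[X], MvPolynomial.eval₂Hom (algebraMap k N) ![x, 1, y] p =
      aeval x P + aeval x Q * y := by
  induction p using MvPolynomial.induction_on with
  | C c => exact ⟨C c, 0, by simp⟩
  | add p q hp hq =>
    obtain ⟨P, Q, e⟩ := hp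
    obtain ⟨P', Q', e'⟩ := hq
    exact ⟨P + P', Q + Q', by rw [map_add, e, e', map_add, map_add]; ring⟩
  | mul_X p n hp =>
    obtain ⟨P, Q, e⟩ := hp
    rw [map_mul, e]
    fin_cases n
    · exact ⟨P * X, Q * X, by simp; ring⟩
    · exact ⟨P, Q, by simp⟩
    · exact ⟨Q * f, P, by simp [← h]; ring⟩

/-- A fraction `p(z, t, w) / t ^ k` with `p` of weight `k` equals `p(x, 1, y)`, and even powers of
`y` reduce to polynomials in `x`. -/
theorem exists_chart_repr {g : ℕ} {a : ℂ} (ha : a ∉ excluded g) (n : AffineChart g a) :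
    ∃ P Q : ℂ[X], n = aeval (chartX g a) P + aeval (chartX g a) Q * chartY g a := by
  obtain ⟨k, u, hu, rfl⟩ := Away.mk_surjective _ (coordT_mem g a) n
  obtain ⟨p, hp, hpu⟩ := id hu
  obtain ⟨P, Q, e⟩ := exists_eq_add_mul_of_sq_eq (chartY_sq ha) p
  refine ⟨P, Q, ?_⟩
  rw [← e]
  refine chartVal_injective g a (((isUnit_coordT g a).pow k).mul_right_cancel ?_)
  refine (val_awayMk_mul _ (coordT_mem g a) k u hu).trans ?_
  have hp' : p.IsWeightedHomogeneous (weights g) k := by simpa using hp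
  have h1 := eval₂_weightedHomogeneous ((chartVal g a).comp (algebraMap ℂ _)) hp'
    (chartVal g a (chartX g a)) (chartVal g a (chartY g a)) (algebraMap _ _ (coordT g a))
  have h2 : (chartVal g a).comp (MvPolynomial.eval₂Hom (algebraMap ℂ _)
      ![chartX g a, 1, chartY g a]) = MvPolynomial.eval₂Hom ((chartVal g a).comp (algebraMap ℂ _))
      ![chartVal g a (chartX g a), 1, chartVal g a (chartY g a)] := by
    refine MvPolynomial.ringHom_ext (fun c => by simp) fun n => ?_
    fin_cases n <;> simp
  have h3 : (algebraMap (CoordRing g a) (Localization.Away (coordT g a))).comp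
      (coordMk g a).toRingHom = MvPolynomial.eval₂Hom ((chartVal g a).comp (algebraMap ℂ _))
      ![chartVal g a (chartX g a) * algebraMap _ _ (coordT g a), algebraMap _ _ (coordT g a),
        chartVal g a (chartY g a) * algebraMap _ _ (coordT g a) ^ (g + 1)] := by
    rw [chartVal_chartX, chartVal_chartY]
    refine MvPolynomial.ringHom_ext (fun c => ?_) fun n => ?_
    · rw [MvPolynomial.eval₂Hom_C]
      exact (chartVal_algebraMap g a c).symm
    · rw [MvPolynomial.eval₂Hom_X']
      fin_cases n <;> rfl
  rw [← hpu]
  have h2' := congrArg (fun h => h p) h2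
  have h3' := congrArg (fun h => h p) h3
  exact (h3'.trans h1).trans (congrArg (· * _) h2'.symm)

/-- Setting `t = 1` maps the chart to `ℂ[X][Y] / (Y² - f)`, where a polynomial of degree at most 1
in `Y` vanishes only if it is zero. -/
theorem chart_eq_zero {g : ℕ} {a : ℂ} (ha : a ∉ excluded g) (P Q : ℂ[X])
    (h : aeval (chartX g a) P + aeval (chartX g a) Q * chartY g a = 0) : P = 0 ∧ Q = 0 := by
  set E : ℂ[X][X] := X ^ 2 - C (affinePoly g a) with hE
  have hroot : AdjoinRoot.root E ^ 2 = AdjoinRoot.of E (affinePoly g a) := by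
    have := AdjoinRoot.eval₂_root E
    rw [hE] at this
    simpa [sub_eq_zero] using this
  let i : ℂ →+* AdjoinRoot E := (AdjoinRoot.of E).comp C
  let θ : CoordRing g a →+* AdjoinRoot E := coordLift ha i (AdjoinRoot.of E X) 1
    (AdjoinRoot.root E) (by rw [hroot, affinePoly, map_prod]; simp [i])
  have hθt : θ (coordT g a) = 1 := by simp [θ, coordLift_mk]
  let θ' : Localization.Away (coordT g a) →+* AdjoinRoot E :=
    IsLocalization.Away.lift (coordT g a) (g := θ) (by rw [hθt]; exact isUnit_one)
  have hθ' (u) : θ' (algebraMap _ _ u) = θ u := IsLocalization.Away.lift_eq _ _ _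
  let ν : AffineChart g a →+* AdjoinRoot E := θ'.comp (chartVal g a)
  have hνx : ν (chartX g a) = AdjoinRoot.of E X := by
    have := congrArg θ' (chartVal_chartX g a)
    rw [map_mul, hθ', hθ', hθt, mul_one] at this
    exact this.trans ((coordLift_mk ..).trans (by simp))
  have hνy : ν (chartY g a) = AdjoinRoot.root E := by
    have := congrArg θ' (chartVal_chartY g a)
    rw [map_mul, map_pow, hθ', hθ', hθt, one_pow, mul_one] at this
    exact this.trans ((coordLift_mk ..).trans (by simp))
  have hνP (P : ℂ[X]) : ν (aeval (chartX g a) P) = AdjoinRoot.of E P := by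
    have : ν.comp (aeval (chartX g a)).toRingHom = AdjoinRoot.of E := by
      refine Polynomial.ringHom_ext (fun c => ?_) (by simp [hνx])
      change ν (aeval (chartX g a) (C c)) = _
      rw [aeval_C]
      change θ' (chartVal g a _) = _
      rw [chartVal_algebraMap, hθ', ← AlgHom.commutes (coordMk g a), coordLift_mk,
        MvPolynomial.algebraMap_eq, MvPolynomial.eval₂Hom_C]
      rfl
    exact congrArg (fun h => h P) this
  have h1 := congrArg ν h
  rw [map_add, map_mul, hνP, hνP, hνy, map_zero] at h1
  have h2 : E ∣ C Q * X + C P := by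
    rw [← AdjoinRoot.mk_eq_zero, map_add, map_mul, AdjoinRoot.mk_C, AdjoinRoot.mk_C,
      AdjoinRoot.mk_X, add_comm]
    exact h1
  have h3 : C Q * X + C P = 0 := by
    refine eq_zero_of_dvd_of_natDegree_lt h2 ?_
    rw [hE, natDegree_X_pow_sub_C]
    exact lt_of_le_of_lt natDegree_linear_le one_lt_two
  constructor
  · simpa using congrArg (fun p => coeff p 0) h3
  · simpa using congrArg (fun p => coeff p 1) h3

theorem coordT_ne_zero {g : ℕ} {a : ℂ} (ha : a ∉ excluded g) : coordT g a ≠ 0 := by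
  intro h0
  have h1 : (1 : Localization.Away (coordT g a)) = 0 :=
    (isUnit_zero_iff.1 (by simpa [h0] using isUnit_coordT g a) ▸ rfl)
  have h2 : (1 : AffineChart g a) = 0 := chartVal_injective g a (by simpa using h1)
  exact one_ne_zero (chart_eq_zero ha 1 0 (by simpa using h2)).1

theorem isDomain_affineChart {g : ℕ} {a : ℂ} (ha : a ∉ excluded g) :
    IsDomain (AffineChart g a) := by
  have := isDomain_coordRing ha
  have : IsDomain (Localization.Away (coordT g a)) :=
    IsLocalization.isDomain_localization (powers_le_nonZeroDivisors_of_noZeroDivisors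
      (coordT_ne_zero ha))
  exact (chartVal_injective g a).isDomain

/-! ### Function fields -/

/-- An open immersion of irreducible schemes over a base `S` induces an isomorphism of function
fields that is compatible with the functions on `S`. -/
theorem exists_functionField_ringEquiv {U X S : Scheme} [IrreducibleSpace U] [IrreducibleSpace X]
    (j : U ⟶ X) [IsOpenImmersion j] (p : X ⟶ S) (q : U ⟶ S) (hq : j ≫ p = q) :
    ∃ ψ : X.functionField ≃+* U.functionField, ∀ c : Γ(S, ⊤),
      ψ (X.presheaf.germ ⊤ (genericPoint X) trivial (p.appTop c)) =
        U.presheaf.germ ⊤ (genericPoint U) trivial (q.appTop c) := by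
  subst hq
  have hgen : j (genericPoint U) = genericPoint X := genericPoint_eq_of_isOpenImmersion j
  have hspec : j (genericPoint U) ⤳ genericPoint X := hgen ▸ specializes_refl _
  let i : X.functionField ≅ U.functionField :=
    X.presheaf.stalkCongr (.of_eq hgen.symm) ≪≫ asIso (j.stalkMap (genericPoint U))
  refine ⟨i.commRingCatIsoToRingEquiv, fun c => ?_⟩
  have h : X.presheaf.germ ⊤ (genericPoint X) trivial ≫ i.hom =
      j.appTop ≫ U.presheaf.germ ⊤ (genericPoint U) trivial := by
    simp only [i, Iso.trans_hom, asIso_hom, TopCat.Presheaf.stalkCongr_hom]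
    have h₁ := X.presheaf.germ_stalkSpecializes (U := ⊤) (TopologicalSpace.Opens.mem_top (genericPoint X)) hspec
    exact (Category.assoc _ _ _).symm.trans
      ((congrArg (· ≫ j.stalkMap _) h₁).trans (Scheme.Hom.germ_stalkMap j ⊤ _ trivial))
  have h' := congrArg (fun f => f.hom (p.appTop c)) h
  refine h'.trans ?_
  simp
  rfl

/-- The zero ideal is a point of `Proj`, since `t` shows that it does not contain the irrelevant
ideal, and its closure is everything. -/
theorem irreducibleSpace_proj {A σ : Type*} [CommRing A] [IsDomain A] [SetLike σ A]
    [AddSubgroupClass σ A] (𝒜 : ℕ → σ) [GradedRing 𝒜] {t : A} {d : ℕ} (ht : t ∈ 𝒜 d)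
    (hd : 0 < d) (h0 : t ≠ 0) : IrreducibleSpace (Proj 𝒜) := by
  let η : ProjectiveSpectrum 𝒜 := ⟨⊥, by
    change (⊥ : Ideal A).IsPrime
    infer_instance, fun h => h0 (h (by
      rw [HomogeneousIdeal.mem_irrelevant_iff, GradedRing.proj_apply,
        DirectSum.decompose_of_mem_ne 𝒜 ht hd.ne']))⟩
  have hη : closure ({η} : Set (ProjectiveSpectrum 𝒜)) = Set.univ := by
    refine Set.eq_univ_of_forall fun x => (ProjectiveSpectrum.le_iff_mem_closure 𝒜 η x).1 ?_
    change (⊥ : HomogeneousIdeal 𝒜) ≤ _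
    exact bot_le
  have hirr : IsIrreducible (Set.univ : Set (ProjectiveSpectrum 𝒜)) :=
    hη ▸ isIrreducible_singleton.closure
  change IrreducibleSpace (ProjectiveSpectrum 𝒜)
  exact { isPreirreducible_univ := hirr.2, toNonempty := ⟨η⟩ }

theorem irreducibleSpace_curve {g : ℕ} {a : ℂ} (ha : a ∉ excluded g) :
    IrreducibleSpace (curve g a).left :=
  have := isDomain_coordRing ha
  irreducibleSpace_proj (coordGrading g a) (coordT_mem g a) one_pos (coordT_ne_zero ha)

theorem exists_functionField_spec_ringEquiv (R : CommRingCat) [IsDomain R] :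
    ∃ ψ : (Spec R).functionField ≃+* FractionRing R, ∀ r : R,
      ψ ((Spec R).presheaf.germ ⊤ (genericPoint (Spec R)) trivial ((Scheme.ΓSpecIso R).inv r)) =
        algebraMap R (FractionRing R) r :=
  ⟨(IsLocalization.algEquiv (nonZeroDivisors R) (Spec R).functionField
    (FractionRing R)).toRingEquiv, fun r => AlgEquiv.commutes _ r⟩

/-- The inclusion of the chart `t ≠ 0` into the curve. -/
noncomputable def chartι (g : ℕ) (a : ℂ) :
    Spec (CommRingCat.of (AffineChart g a)) ⟶ (curve g a).left :=
  Proj.awayι (coordGrading g a) (coordT g a) (coordT_mem g a) one_pos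

instance (g : ℕ) (a : ℂ) : IsOpenImmersion (chartι g a) :=
  inferInstanceAs (IsOpenImmersion (Proj.awayι _ _ (coordT_mem g a) one_pos))

theorem chartι_hom (g : ℕ) (a : ℂ) : chartι g a ≫ (curve g a).hom =
      Spec.map (CommRingCat.ofHom (algebraMap ℂ (AffineChart g a))) := by
  change Proj.awayι _ _ (coordT_mem g a) one_pos ≫ (Proj.toSpecZero _ ≫ _) = _
  rw [Proj.awayι_toSpecZero_assoc, ← Spec.map_comp]
  rfl

/-- The function field can be computed on the chart `t ≠ 0`. Tracking constants makes the comparison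
`ℂ`-linear, without which `a` and `b` could not be compared. -/
theorem exists_functionField_curve_ringEquiv {g : ℕ} {a : ℂ} [IsDomain (AffineChart g a)]
    [IrreducibleSpace (curve g a).left] :
    ∃ ψ : (curve g a).left.functionField ≃+* FractionRing (AffineChart g a), ∀ c : ℂ,
      ψ ((curve g a).left.presheaf.germ ⊤ (genericPoint (curve g a).left) trivial
        ((curve g a).hom.appTop ((Scheme.ΓSpecIso (CommRingCat.of ℂ)).inv c))) =
        algebraMap ℂ (FractionRing (AffineChart g a)) c := by
  have : IsDomain (CommRingCat.of (AffineChart g a)) := ‹_›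
  obtain ⟨ψ, hψ⟩ := exists_functionField_ringEquiv (chartι g a) (curve g a).hom _ (chartι_hom g a)
  obtain ⟨ψ', hψ'⟩ := exists_functionField_spec_ringEquiv (CommRingCat.of (AffineChart g a))
  refine ⟨ψ.trans ψ', fun c => (congrArg ψ' (hψ _)).trans ?_⟩
  have h := congrArg (fun f => f.hom c) (Scheme.ΓSpecIso_inv_naturality
    (CommRingCat.ofHom (algebraMap ℂ (AffineChart g a))))
  exact (congrArg (fun s => ψ' ((Spec _).presheaf.germ ⊤ (genericPoint _) trivial s)) h.symm).trans
    (hψ' _)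

/-- Isomorphic curves have isomorphic function fields over `ℂ`. -/
theorem nonempty_fractionRing_algEquiv {g : ℕ} {a b : ℂ} (ha : a ∉ excluded g)
    (hb : b ∉ excluded g) [IsDomain (AffineChart g a)] [IsDomain (AffineChart g b)]
    (e : curve g a ≅ curve g b) :
    Nonempty (FractionRing (AffineChart g b) ≃ₐ[ℂ] FractionRing (AffineChart g a)) := by
  have := irreducibleSpace_curve ha
  have := irreducibleSpace_curve hb
  obtain ⟨ψa, ha'⟩ := exists_functionField_curve_ringEquiv (g := g) (a := a)
  obtain ⟨ψb, hb'⟩ := exists_functionField_curve_ringEquiv (g := g) (a := b)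
  have : IsIso e.hom.left := inferInstanceAs (IsIso ((Over.forget _).map e.hom))
  obtain ⟨ψ, hψ⟩ := exists_functionField_ringEquiv e.hom.left (curve g b).hom (curve g a).hom
    (Over.w e.hom)
  refine ⟨AlgEquiv.ofRingEquiv (f := (ψb.symm.trans ψ).trans ψa) fun c => ?_⟩
  rw [← hb', ← ha', RingEquiv.trans_apply, RingEquiv.trans_apply, RingEquiv.symm_apply_apply, hψ]

theorem IsHyperellipticPair.map {k L L' : Type*} [Field k] [Field L] [Field L'] [Algebra k L]
    [Algebra k L'] {f : k[X]} {x y : L} (h : IsHyperellipticPair f x y) (ψ : L ≃ₐ[k] L') :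
    IsHyperellipticPair f (ψ x) (ψ y) where
  sq_eq := by rw [← map_pow, h.sq_eq, aeval_algHom_apply]
  eq_zero P Q hPQ := by
    refine h.eq_zero P Q (ψ.injective ?_)
    rw [map_add, map_mul, map_zero, ← aeval_algHom_apply, ← aeval_algHom_apply, hPQ]
  exists_repr u := by
    obtain ⟨P, Q, R, hR, e⟩ := h.exists_repr (ψ.symm u)
    refine ⟨P, Q, R, hR, ?_⟩
    have := congrArg ψ e
    rw [map_add, map_mul, map_mul, ψ.apply_symm_apply] at this
    rw [aeval_algHom_apply, aeval_algHom_apply, aeval_algHom_apply, this]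

/-- Isomorphic curves of the family are related by a Möbius transformation mapping branch points
to branch points. -/
theorem exists_mobius_of_iso {g : ℕ} (hg : 3 ≤ g) {a b : ℂ} (ha : a ∉ excluded g)
    (hb : b ∉ excluded g) (e : curve g a ≅ curve g b) :
    ∃ α β γ δ : ℂ, α * δ - β * γ ≠ 0 ∧ ∀ r ∈ branchPoints g a, ∃ s ∈ branchPoints g b,
      α * r + β = s * (γ * r + δ) := by
  have := isDomain_affineChart ha
  have := isDomain_affineChart hb
  obtain ⟨ψ⟩ := nonempty_fractionRing_algEquiv ha hb e
  have pa : IsHyperellipticPair (affinePoly g a) (algebraMap _ (FractionRing (AffineChart g a)) (chartX g a))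
      (algebraMap _ (FractionRing (AffineChart g a)) (chartY g a)) :=
    isHyperellipticPair_of_isFractionRing (chartY_sq ha) (chart_eq_zero ha) (exists_chart_repr ha)
  have pb : IsHyperellipticPair (affinePoly g b) (algebraMap _ (FractionRing (AffineChart g b)) (chartX g b))
      (algebraMap _ (FractionRing (AffineChart g b)) (chartY g b)) :=
    isHyperellipticPair_of_isFractionRing (chartY_sq hb) (chart_eq_zero hb) (exists_chart_repr hb)
  have pb' := pb.map ψ
  obtain ⟨α, β, γ, δ, hD, h⟩ := pa.exists_mobius (T := branchPoints g b)
    ⟨g + 1, by rw [card_branchPoints hb]; ring⟩ pb' (affinePoly_squarefree g a)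
    (by rw [natDegree_affinePoly ha]; omega)
  exact ⟨α, β, γ, δ, hD, fun r hr => h r (isRoot_affinePoly hr)⟩

end HyperellipticFamily

theorem mainTheorem6 (g : ℕ) (hg : 3 ≤ g) (a b : ℂ)
    (ha : a ∉ Set.range (fun q : ℚ => (q : ℂ)))
    (hb : b ∉ HyperellipticFamily.excluded g) :
    Nonempty (HyperellipticFamily.curve g a ≅ HyperellipticFamily.curve g b) ↔ a = b := by
  refine ⟨fun ⟨e⟩ => ?_, fun h => h ▸ ⟨Iso.refl _⟩⟩
  -- The excluded values are integers, so an irrational `a` avoids them.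
  have ha' : a ∉ HyperellipticFamily.excluded g := fun h => by
    obtain ⟨n, -, rfl⟩ := HyperellipticFamily.mem_excluded_iff.1 h
    exact ha ⟨n, by simp⟩
  obtain ⟨α, β, γ, δ, hD, h⟩ := HyperellipticFamily.exists_mobius_of_iso hg ha' hb e
  refine HyperellipticFamily.eq_of_mobius hg ha hD fun r hr => ?_
  obtain ⟨s, hs, hs'⟩ := h r (HyperellipticFamily.mem_branchPoints.2 hr)
  exact ⟨s, HyperellipticFamily.mem_branchPoints.1 hs, hs'⟩
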